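/- **Theorem.** Let $p\ge 1$ and $n>p+2$ be integers, let $q,\theta,s\in\mathbb R$ with $\theta>0$, $s>0$, $2q+p>2$, let $\mu\in\mathbb R^p$, and let $\Sigma$ be a real symmetric positive definite $p\times p$ matrix. Let the random vectors $x_1,\dots,x_n$ in $\mathbb R^p$ have the joint density (Kotz-type model) $$f(x_1,\dots,x_n)=|\Sigma|^{-n/2}\,h\Big(\sum_{i=1}^n (x_i-\mu)'\Sigma^{-1}(x_i-\mu)\Big),\qquad h(z)=\frac{s\,\theta^{\frac{2q+pn-2}{2s}}\,\Gamma\left(\frac{pn}{2}\right)}{\pi^{\frac{pn}{2}}\,\Gamma\left(\frac{2q+pn-2}{2s}\right)}\,z^{q-1}e^{-\theta z^s},$$ and let $KW_p(n-1,\Sigma)$ (the Kotz-Wishart distribution) denote the law of $\sum_{i=1}^n (x_i-\bar x)(x_i-\bar x)'$, where $\bar x=\frac1n\sum_{i=1}^n x_i$. Let $A$ be a random matrix with law $KW_p(n-1,\Sigma)$, put $\nu=n-1$, and for an estimator $\Delta=\Delta(A)$ of the precision matrix $\Sigma^{-1}$ let $$R(\Sigma^{-1},\Delta)=E\left[\frac{\operatorname{tr}\left[(\Delta-\Sigma^{-1})^2A\right]}{\nu\,\operatorname{tr}(\Sigma^{-1})}\right]$$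 be its risk under the Efron-Morris loss. Put $$c_0=\frac{(n-p-2)\,\Gamma\left(\frac{2q+np-2}{2s}\right)}{\theta^{1/s}(np-2)\,\Gamma\left(\frac{2q+np-4}{2s}\right)},\qquad c_1=\frac{(n-1)\,\theta^{-1/s}\,\Gamma\left(\frac{2q+np}{2s}\right)}{np\,\Gamma\left(\frac{2q+np-2}{2s}\right)}.$$ Then $A$ is almost surely positive definite, $E(A)=c_1\Sigma$, and $\Delta_0=c_0A^{-1}$ is an unbiased estimator of $\Sigma^{-1}$, that is, $E(c_0A^{-1})=\Sigma^{-1}$. Every estimator $\alpha A^{-1}$, $\alpha\in\mathbb R$, has finite risk; among these estimators $\Delta_0$ is the unique one of smallest risk, that is, $R(\Sigma^{-1},\Delta_0)<R(\Sigma^{-1},\alpha A^{-1})$ for every real $\alpha\ne c_0$; and $$R(\Sigma^{-1},\Delta_0)=\frac{c_1-c_0}{\nu}.$$ -/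

import Mathlib

open MeasureTheory ProbabilityTheory

noncomputable section

/-- The generator `h` of the Kotz-type model for `n` vectors in dimension `p`, with parameters
`q`, `θ`, `s`. -/
def kotzGenerator (p n : ℕ) (q θ s z : ℝ) : ℝ :=
  s * θ ^ ((2 * q + p * n - 2) / (2 * s)) * Real.Gamma (p * n / 2) /
      (Real.pi ^ ((p * n : ℝ) / 2) * Real.Gamma ((2 * q + p * n - 2) / (2 * s))) *
    z ^ (q - 1) * Real.exp (-θ * z ^ s)

/-- The joint density `|S|^{-n/2} h(∑ᵢ (xᵢ - m)ᵀ S⁻¹ (xᵢ - m))` of a sample `x₁, …, xₙ` from the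
multivariate Kotz-type model. -/
def kotzDensity {p n : ℕ} (q θ s : ℝ) (m : Fin p → ℝ) (S : Matrix (Fin p) (Fin p) ℝ)
    (x : Fin n → Fin p → ℝ) : ℝ :=
  S.det ^ (-(n : ℝ) / 2) *
    kotzGenerator p n q θ s (∑ i, (x i - m) ⬝ᵥ (S⁻¹.mulVec (x i - m)))

/-- The law of a sample of size `n` from the multivariate Kotz-type model: the measure on
`(ℝᵖ)ⁿ` with density `kotzDensity` with respect to Lebesgue measure. -/
def kotzModel (p n : ℕ) (q θ s : ℝ) (m : Fin p → ℝ) (S : Matrix (Fin p) (Fin p) ℝ) :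
    Measure (Fin n → Fin p → ℝ) :=
  volume.withDensity fun x => ENNReal.ofReal (kotzDensity q θ s m S x)

/-- The sample mean. -/
def sampleMean {p n : ℕ} (x : Fin n → Fin p → ℝ) : Fin p → ℝ :=
  (n : ℝ)⁻¹ • ∑ i, x i

/-- The matrix of sums of squares and products, `∑ᵢ (xᵢ - x̄)(xᵢ - x̄)ᵀ`. -/
def sspMatrix {p n : ℕ} (x : Fin n → Fin p → ℝ) : Matrix (Fin p) (Fin p) ℝ :=
  ∑ i, Matrix.vecMulVec (x i - sampleMean x) (x i - sampleMean x)

/-- The product (Borel) sigma-algebra on real matrices: the one generated by the entries. -/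
instance matrixMeasurableSpace (p : ℕ) : MeasurableSpace (Matrix (Fin p) (Fin p) ℝ) :=
  inferInstanceAs (MeasurableSpace (Fin p → Fin p → ℝ))

/-- The Kotz-Wishart distribution `KW_p(n - 1, S)`: the law of the matrix of sums of squares and
products of a sample of size `n` from the Kotz-type model with location `m`. -/
def kotzWishart (p n : ℕ) (q θ s : ℝ) (m : Fin p → ℝ) (S : Matrix (Fin p) (Fin p) ℝ) :
    Measure (Matrix (Fin p) (Fin p) ℝ) :=
  (kotzModel p n q θ s m S).map sspMatrix

/-- The Efron-Morris loss of the estimate `D` of `S⁻¹` when the observed matrix is `A`. -/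
def efronMorrisLoss {p : ℕ} (ν : ℝ) (S D A : Matrix (Fin p) (Fin p) ℝ) : ℝ :=
  ((D - S⁻¹) ^ 2 * A).trace / (ν * (S⁻¹).trace)

/-- The risk of the estimator `D(A)` of `S⁻¹`: its expected Efron-Morris loss. -/
def efronMorrisRisk {Ω : Type*} [MeasurableSpace Ω] {p : ℕ} (P : Measure Ω)
    (A : Ω → Matrix (Fin p) (Fin p) ℝ) (ν : ℝ) (S : Matrix (Fin p) (Fin p) ℝ)
    (D : Matrix (Fin p) (Fin p) ℝ → Matrix (Fin p) (Fin p) ℝ) : ℝ :=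
  ∫ ω, efronMorrisLoss ν S (D (A ω)) (A ω) ∂P

/-- The factor `c₀` for which `c₀ A⁻¹` is unbiased. -/
def kotzC0 (p n : ℕ) (q θ s : ℝ) : ℝ :=
  ((n : ℝ) - p - 2) * Real.Gamma ((2 * q + n * p - 2) / (2 * s)) /
    (θ ^ (1 / s) * (n * p - 2) * Real.Gamma ((2 * q + n * p - 4) / (2 * s)))

/-- The factor `c₁` in `E(A) = c₁ S`. -/
def kotzC1 (p n : ℕ) (q θ s : ℝ) : ℝ :=
  ((n : ℝ) - 1) * θ ^ (-1 / s) * Real.Gamma ((2 * q + n * p) / (2 * s)) /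
    (n * p * Real.Gamma ((2 * q + n * p - 2) / (2 * s)))

end

open scoped ENNReal

/-! Write `S = T * Tᵀ` and substitute `x = m + T y`. The vectors `y` then have a density depending
only on the sum of squares of all their coordinates, and `A` becomes `T * W * Tᵀ` with `W =
sspMatrix y`. Everything about `A` follows from two identities, `E W = c₁ 1` and `E W⁻¹ = c₀⁻¹ 1`.

For a function homogeneous of degree `k`, integration against a radial density factors into an
angular constant and a one-dimensional moment, and the angular constant does not see the density
(`exists_lintegral_homogeneous_mul_kotzRadial`). The diagonal of `W⁻¹` has degree `-2`, so its
constant may be found from the Gaussian density, the case `q = 1`, `θ = 1/2`, `s = 1`. There the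
columns of the sample are independent, and `(W⁻¹) j j` is the inverse squared distance of column `j`
to the span of the ones vector and the other columns (`inv_sspMatrix_apply_self`). Given the other
columns, this is an inverse chi-square variable with `n - p` degrees of freedom, of mean `1 / (n - p
- 2)`. Ratios of Gamma values carry this to the Kotz density.

Off-diagonal means vanish by sign changes. The mean of `W` comes from the second moments of the
coordinates, which sign changes and permutations reduce to the mean of the sum of squares.

Finally the loss of `α A⁻¹` expands so that its risk is `(α² / c₀ - 2 α + c₁) / ν`, a parabola with
its minimum at `α = c₀`. -/

/-! ### Polar coordinates and homogeneous functions. -/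

theorem lintegral_eq_lintegral_toSphere {E : Type*} [NormedAddCommGroup E] [NormedSpace ℝ E]
    [Nontrivial E] [FiniteDimensional ℝ E] [MeasurableSpace E] [BorelSpace E]
    (μ : Measure E) [μ.IsAddHaarMeasure] {g : E → ℝ≥0∞} (hg : Measurable g) :
    ∫⁻ x, g x ∂μ = ∫⁻ u, (∫⁻ r in Set.Ioi (0 : ℝ),
      ENNReal.ofReal (r ^ (Module.finrank ℝ E - 1)) * g (r • (u : E))) ∂μ.toSphere := by
  have h1 : ∫⁻ x, g x ∂μ = ∫⁻ x : ({(0 : E)}ᶜ : Set E), g x ∂(μ.comap (↑)) := by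
    rw [lintegral_subtype_comap (measurableSet_singleton _).compl, restrict_compl_singleton]
  have h2 : ∫⁻ x : ({(0 : E)}ᶜ : Set E), g x ∂(μ.comap (↑)) =
      ∫⁻ x : Metric.sphere (0 : E) 1 × Set.Ioi (0 : ℝ), g ((x.2 : ℝ) • (x.1 : E))
        ∂(μ.toSphere.prod (.volumeIoiPow (Module.finrank ℝ E - 1))) := by
    rw [← (μ.measurePreserving_homeomorphUnitSphereProd).lintegral_comp_emb
      (Homeomorph.measurableEmbedding _)]
    refine lintegral_congr fun x => ?_
    congr 1
    have := congrArg Subtype.val ((homeomorphUnitSphereProd E).symm_apply_apply x)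
    rw [homeomorphUnitSphereProd_symm_apply_coe] at this
    exact this.symm
  rw [h1, h2, lintegral_prod _ (by fun_prop)]
  refine lintegral_congr fun u => ?_
  rw [Measure.volumeIoiPow, lintegral_withDensity_eq_lintegral_mul _ (by fun_prop) (by fun_prop)]
  exact lintegral_subtype_comap measurableSet_Ioi
    (fun r : ℝ => ENNReal.ofReal (r ^ (Module.finrank ℝ E - 1)) * g (r • (u : E)))

theorem lintegral_Ioi_comp_mul_left {f : ℝ → ℝ≥0∞} (hf : Measurable f) {a : ℝ} (ha : 0 < a) :
    ∫⁻ r in Set.Ioi (0 : ℝ), f r = ENNReal.ofReal a * ∫⁻ r in Set.Ioi (0 : ℝ), f (a * r) := by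
  rw [← lintegral_indicator measurableSet_Ioi, ← lintegral_indicator measurableSet_Ioi]
  conv_lhs => rw [← Real.smul_map_volume_mul_left ha.ne']
  rw [lintegral_smul_measure, abs_of_pos ha, smul_eq_mul, lintegral_map
    (hf.indicator measurableSet_Ioi) (by fun_prop)]
  congr 1
  refine lintegral_congr fun r => ?_
  by_cases hr : 0 < r
  · rw [Set.indicator_of_mem (Set.mem_Ioi.2 (mul_pos ha hr)), Set.indicator_of_mem (Set.mem_Ioi.2 hr)]
  · rw [Set.indicator_of_notMem, Set.indicator_of_notMem (by simpa using hr)]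
    simpa using mul_nonpos_of_nonneg_of_nonpos ha.le (not_lt.1 hr)

/-- The integral of a function homogeneous of degree `k` times a function of a gauge splits into
a radial integral and a constant which does not depend on the radial factor. -/
theorem exists_lintegral_homogeneous_mul_radial {E : Type*} [NormedAddCommGroup E]
    [NormedSpace ℝ E] [Nontrivial E] [FiniteDimensional ℝ E] [MeasurableSpace E] [BorelSpace E]
    (μ : Measure E) [μ.IsAddHaarMeasure] {N : E → ℝ} (hN : Measurable N)
    (hNpos : ∀ y, y ≠ 0 → 0 < N y) (hNhom : ∀ r : ℝ, 0 < r → ∀ y, N (r • y) = r * N y)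
    {F : E → ℝ≥0∞} (hF : Measurable F) (k : ℝ)
    (hFhom : ∀ r : ℝ, 0 < r → ∀ y, F (r • y) = ENNReal.ofReal (r ^ k) * F y) :
    ∃ C : ℝ≥0∞, ∀ ρ : ℝ → ℝ≥0∞, Measurable ρ → ∫⁻ y, F y * ρ (N y) ∂μ =
      C * ∫⁻ r in Set.Ioi (0 : ℝ), ENNReal.ofReal (r ^ ((Module.finrank ℝ E : ℝ) - 1 + k)) * ρ r := by
  -- On the ray through `u` the integrand is `r ^ (d - 1 + k) * F u * ρ (r * N u)`; rescaling the
  -- radius by `N u` leaves the weight `N u ^ (-(d + k))` on the sphere.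
  refine ⟨∫⁻ u, F u * ENNReal.ofReal ((N (u : E)) ^ (-((Module.finrank ℝ E : ℝ) + k))) ∂μ.toSphere,
    fun ρ hρ => ?_⟩
  set d := Module.finrank ℝ E
  have hd : 1 ≤ d := Module.finrank_pos
  rw [lintegral_eq_lintegral_toSphere μ (by fun_prop), ← lintegral_mul_const _ (by fun_prop)]
  refine lintegral_congr fun u => ?_
  have hu : 0 < N (u : E) := hNpos _ (by
    intro h
    have := u.2
    rw [h] at this
    simp at this)
  rw [lintegral_Ioi_comp_mul_left (f := fun r => ENNReal.ofReal (r ^ ((d : ℝ) - 1 + k)) * ρ r)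
    (by fun_prop) hu, ← mul_assoc, ← lintegral_const_mul _ (by fun_prop)]
  refine setLIntegral_congr_fun measurableSet_Ioi fun r hr => ?_
  have hr : 0 < r := hr
  rw [hFhom r hr, hNhom r hr, mul_comm r (N _), ← mul_assoc, ← mul_assoc, ← mul_assoc]
  congr 1
  rw [mul_comm _ (F u), mul_assoc, mul_assoc]
  congr 1
  rw [← ENNReal.ofReal_mul (by positivity), ← ENNReal.ofReal_mul (by positivity),
    ← ENNReal.ofReal_mul (by positivity)]
  congr 1
  rw [show Module.finrank ℝ E = d from rfl, Real.mul_rpow hu.le hr.le, ← Real.rpow_natCast, Nat.cast_sub hd, Nat.cast_one]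
  rw [show (d : ℝ) - 1 + k = ((d : ℝ) + k) + (-1) by ring, Real.rpow_add hu, Real.rpow_neg hu.le,
    Real.rpow_neg_one, show ((d : ℝ) + k) + (-1) = ((d : ℝ) - 1) + k by ring, Real.rpow_add hr]
  have := (Real.rpow_pos_of_pos hu ((d : ℝ) + k)).ne'
  field_simp

/-! ### Densities under linear automorphisms. -/

theorem map_withDensity_comp {X Y : Type*} [MeasurableSpace X] [MeasurableSpace Y] (μ : Measure X)
    {φ : X → Y} (hφ : Measurable φ) {f : Y → ℝ≥0∞} (hf : Measurable f) :
    (μ.withDensity fun x => f (φ x)).map φ = (μ.map φ).withDensity f := by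
  ext s hs
  rw [Measure.map_apply hφ hs, withDensity_apply _ (hφ hs), withDensity_apply _ hs,
    ← lintegral_indicator hs, lintegral_map (hf.indicator hs) hφ, ← lintegral_indicator (hφ hs)]
  refine lintegral_congr fun x => ?_
  by_cases hx : φ x ∈ s
  · rw [Set.indicator_of_mem (Set.mem_preimage.2 hx), Set.indicator_of_mem hx]
  · rw [Set.indicator_of_notMem (by rwa [Set.mem_preimage]), Set.indicator_of_notMem hx]

/-- A finite measure with a density is preserved by the linear automorphisms which preserve
the density. -/
theorem measurePreserving_withDensity_of_comp_eq {E : Type*} [NormedAddCommGroup E]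
    [NormedSpace ℝ E] [FiniteDimensional ℝ E] [MeasurableSpace E] [BorelSpace E]
    (μ : Measure E) [μ.IsAddHaarMeasure] {f : E → ℝ≥0∞} (hf : Measurable f)
    [IsFiniteMeasure (μ.withDensity f)] (L : E ≃ₗ[ℝ] E) (hL : ∀ x, f (L x) = f x) :
    MeasurePreserving L (μ.withDensity f) (μ.withDensity f) := by
  have hLm : Measurable L := L.toLinearMap.continuous_of_finiteDimensional.measurable
  refine ⟨hLm, ?_⟩
  have hdet : LinearMap.det (L : E →ₗ[ℝ] E) ≠ 0 := L.isUnit_det'.ne_zero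
  have hmap := Measure.map_linearMap_addHaar_eq_smul_addHaar μ hdet
  set c : ℝ≥0∞ := ENNReal.ofReal |(LinearMap.det (L : E →ₗ[ℝ] E))⁻¹| with hc
  have key : (μ.withDensity f).map L = c • μ.withDensity f := by
    have h := map_withDensity_comp μ hLm hf
    simp only [hL] at h
    rw [h, ← withDensity_smul_measure, ← hmap]
    rfl
  by_cases h0 : μ.withDensity f = 0
  · rw [h0]; simp
  -- A pushforward keeps the total mass, which is finite and here nonzero, so the Jacobian factor
  -- `c` must be `1`. No determinant has to be computed.
  have hmass := congrArg (fun ν : Measure E => ν Set.univ) key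
  simp only [Measure.map_apply hLm MeasurableSet.univ, Set.preimage_univ, Measure.smul_apply,
    smul_eq_mul] at hmass
  have h1 : c = 1 := by
    have hne : (μ.withDensity f) Set.univ ≠ 0 :=
      fun h => h0 (Measure.measure_univ_eq_zero.1 h)
    have := (ENNReal.mul_left_inj (c := (μ.withDensity f) Set.univ) hne (measure_ne_top _ _)
      (a := 1) (b := c)).1 (by rw [one_mul]; exact hmass)
    exact this.symm
  rw [key, h1, one_smul]

/-! ### Gaussian integrals and the mean of an inverse chi-square variable. -/

theorem lintegral_exp_neg_sum_mul_sq {ι : Type*} [Fintype ι] (b : ι → ℝ) (hb : ∀ i, 0 < b i) :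
    ∫⁻ z : ι → ℝ, ENNReal.ofReal (Real.exp (-∑ i, b i * z i ^ 2)) =
      ENNReal.ofReal (∏ i, √(Real.pi / b i)) := by
  have hint : Integrable (fun z : ι → ℝ => ∏ i, Real.exp (-b i * z i ^ 2)) :=
    Integrable.fintype_prod (f := fun i x => Real.exp (-b i * x ^ 2))
      fun i => integrable_exp_neg_mul_sq (hb i)
  have h : ∀ z : ι → ℝ, Real.exp (-∑ i, b i * z i ^ 2) = ∏ i, Real.exp (-b i * z i ^ 2) := by
    intro z
    rw [← Real.exp_sum, ← Finset.sum_neg_distrib]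
    simp only [neg_mul]
  simp only [h]
  rw [← ofReal_integral_eq_lintegral_ofReal hint (ae_of_all _ fun z => by positivity),
    integral_fintype_prod_volume_eq_prod (f := fun i x => Real.exp (-b i * x ^ 2))]
  simp only [integral_gaussian]

/-- Laplace representation of the reciprocal, which turns inverse moments into Gaussian integrals.
At `s = 0` both sides are `∞`, so no point has to be excluded. -/
theorem lintegral_Ioi_exp_neg_mul {s : ℝ} (hs : 0 ≤ s) :
    ∫⁻ t in Set.Ioi (0 : ℝ), ENNReal.ofReal (Real.exp (-(t * s))) = (ENNReal.ofReal s)⁻¹ := by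
  rcases hs.eq_or_lt with rfl | hs
  · simp
  · have hi : IntegrableOn (fun t : ℝ => Real.exp (-(t * s))) (Set.Ioi 0) := by
      simpa [mul_comm] using integrableOn_exp_mul_Ioi (a := -s) (by linarith) 0
    rw [← ofReal_integral_eq_lintegral_ofReal hi (ae_of_all _ fun z => by positivity)]
    have := integral_exp_mul_Ioi (a := -s) (by linarith) 0
    rw [← ENNReal.ofReal_inv_of_pos hs]
    congr 1
    simpa [mul_comm] using this

theorem lintegral_Ioi_one_add_two_mul_rpow {r : ℝ} (hr : 2 < r) :
    ∫⁻ t in Set.Ioi (0 : ℝ), ENNReal.ofReal ((1 + 2 * t) ^ (-(r / 2))) =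
      ENNReal.ofReal (1 / (r - 2)) := by
  have hd : ∀ x ∈ Set.Ici (0 : ℝ), HasDerivAt (fun t : ℝ => -(1 / (r - 2)) * (1 + 2 * t) ^ (1 - r / 2))
      ((1 + 2 * x) ^ (-(r / 2))) x := by
    intro x hx
    have hx : 0 ≤ x := hx
    have h1 : HasDerivAt (fun t : ℝ => 1 + 2 * t) 2 x := by
      simpa using ((hasDerivAt_id x).const_mul 2).const_add 1
    have h2 := (h1.rpow_const (p := 1 - r / 2) (Or.inl (by positivity))).const_mul (-(1 / (r - 2)))
    refine h2.congr_deriv ?_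
    rw [show 1 - r / 2 - 1 = -(r / 2) by ring]
    have : r - 2 ≠ 0 := by linarith
    field_simp
    ring
  have hpos : ∀ x ∈ Set.Ioi (0 : ℝ), 0 ≤ (1 + 2 * x) ^ (-(r / 2)) := by
    intro x hx
    have hx : 0 < x := hx
    positivity
  have hlim : Filter.Tendsto (fun t : ℝ => -(1 / (r - 2)) * (1 + 2 * t) ^ (1 - r / 2))
      Filter.atTop (nhds 0) := by
    have h1 : Filter.Tendsto (fun t : ℝ => 1 + 2 * t) Filter.atTop Filter.atTop :=
      Filter.tendsto_atTop_add_const_left _ _ (Filter.tendsto_id.const_mul_atTop (by norm_num))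
    have h2 := (tendsto_rpow_neg_atTop (y := r / 2 - 1) (by linarith)).comp h1
    have h3 := h2.const_mul (-(1 / (r - 2)))
    rw [mul_zero] at h3
    refine h3.congr fun t => ?_
    simp [show -(r / 2 - 1) = 1 - r / 2 by ring]
  rw [← ofReal_integral_eq_lintegral_ofReal (integrableOn_Ioi_deriv_of_nonneg' hd hpos hlim)
    ((ae_restrict_mem measurableSet_Ioi).mono hpos),
    integral_Ioi_of_hasDerivAt_of_nonneg' hd hpos hlim]
  simp

/-- The unnormalized standard Gaussian density on `ι → ℝ`. -/
noncomputable def gaussWeight {ι : Type*} [Fintype ι] (z : ι → ℝ) : ℝ≥0∞ :=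
  ENNReal.ofReal (Real.exp (-∑ i, 1 / 2 * z i ^ 2))

@[fun_prop]
theorem measurable_gaussWeight {ι : Type*} [Fintype ι] :
    Measurable (gaussWeight : (ι → ℝ) → ℝ≥0∞) := by
  unfold gaussWeight
  fun_prop

/-- Replace the reciprocal by its Laplace integral and apply Tonelli. For fixed `t` the integrand is
again a product of Gaussians, in which each coordinate of `I` contributes a factor `(1 + 2 t) ^
(-1/2)`. The remaining integral over `t` converges because `I` has more than two elements. -/
theorem lintegral_inv_sum_sq_mul_gaussWeight {ι : Type*} [Fintype ι] (I : Finset ι)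
    (hI : 2 < I.card) :
    ∫⁻ z : ι → ℝ, (ENNReal.ofReal (∑ i ∈ I, z i ^ 2))⁻¹ * gaussWeight z =
      ENNReal.ofReal (1 / ((I.card : ℝ) - 2)) * ∫⁻ z : ι → ℝ, gaussWeight z := by
  classical
  have h1 : ∀ z : ι → ℝ, (ENNReal.ofReal (∑ i ∈ I, z i ^ 2))⁻¹ * gaussWeight z =
      ∫⁻ t in Set.Ioi (0 : ℝ),
        ENNReal.ofReal (Real.exp (-∑ i, (1 / 2 + if i ∈ I then t else 0) * z i ^ 2)) := by
    intro z
    rw [← lintegral_Ioi_exp_neg_mul (Finset.sum_nonneg fun i _ => sq_nonneg _), gaussWeight,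
      ← lintegral_mul_const _ (by fun_prop)]
    refine lintegral_congr fun t => ?_
    rw [← ENNReal.ofReal_mul (by positivity), ← Real.exp_add]
    congr 2
    simp only [add_mul, Finset.sum_add_distrib, ite_mul, zero_mul, Finset.sum_ite_mem,
      Finset.univ_inter, Finset.mul_sum]
    ring
  simp only [h1]
  rw [lintegral_lintegral_swap]
  swap
  · refine Measurable.aemeasurable ?_
    have : ∀ i : ι, Measurable fun x : (ι → ℝ) × ℝ => if i ∈ I then x.2 else 0 := by
      intro i
      split_ifs <;> fun_prop
    simp only [Function.uncurry_def]
    fun_prop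
  have h2 : ∀ t ∈ Set.Ioi (0 : ℝ), ∫⁻ z : ι → ℝ,
      ENNReal.ofReal (Real.exp (-∑ i, (1 / 2 + if i ∈ I then t else 0) * z i ^ 2)) =
      ENNReal.ofReal ((1 + 2 * t) ^ (-((I.card : ℝ) / 2))) * ∫⁻ z : ι → ℝ, gaussWeight z := by
    intro t ht
    have ht : 0 < t := ht
    simp only [gaussWeight]
    rw [lintegral_exp_neg_sum_mul_sq _ (fun i => by split_ifs <;> linarith),
      lintegral_exp_neg_sum_mul_sq _ (fun i => by norm_num), ← ENNReal.ofReal_mul (by positivity)]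
    congr 1
    have h3 : ∀ i, √(Real.pi / (1 / 2 + if i ∈ I then t else 0)) =
        (if i ∈ I then (1 + 2 * t) ^ (-(1 / 2 : ℝ)) else 1) * √(Real.pi / (1 / 2)) := by
      intro i
      split_ifs
      · rw [Real.rpow_neg (by positivity), ← Real.sqrt_eq_rpow, ← Real.sqrt_inv,
          ← Real.sqrt_mul (by positivity)]
        congr 1
        field_simp
      · simp
    simp only [h3]
    rw [Finset.prod_mul_distrib, Finset.prod_ite_mem, Finset.univ_inter, Finset.prod_const,
      ← Real.rpow_natCast, ← Real.rpow_mul (by positivity)]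
    congr 2
    ring
  rw [setLIntegral_congr_fun measurableSet_Ioi h2, lintegral_mul_const _ (by fun_prop),
    lintegral_Ioi_one_add_two_mul_rpow (by exact_mod_cast hI)]

theorem lintegral_gaussWeight {ι : Type*} [Fintype ι] :
    ∫⁻ z : ι → ℝ, gaussWeight z = ENNReal.ofReal (∏ _i : ι, √(Real.pi / (1 / 2))) :=
  lintegral_exp_neg_sum_mul_sq _ fun _ => by norm_num

instance isFiniteMeasure_gaussWeight {ι : Type*} [Fintype ι] :
    IsFiniteMeasure ((volume : Measure (ι → ℝ)).withDensity gaussWeight) :=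
  isFiniteMeasure_withDensity (by rw [lintegral_gaussWeight]; exact ENNReal.ofReal_ne_top)

/-! ### Projections of a Gaussian vector. -/

/-- A subspace of Euclidean space is spanned by some of the vectors of an orthonormal basis, so
the squared norm of the projection is a partial sum of the squared coordinates. -/
theorem exists_orthonormalBasis_norm_sq_starProjection {n : ℕ}
    (K : Submodule ℝ (EuclideanSpace ℝ (Fin n))) :
    ∃ (b : OrthonormalBasis (Fin n) ℝ (EuclideanSpace ℝ (Fin n))) (I : Finset (Fin n)),
      I.card = Module.finrank ℝ K ∧ ∀ z, ‖K.starProjection z‖ ^ 2 = ∑ i ∈ I, (b.repr z i) ^ 2 := by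
  have hr : Module.finrank ℝ K ≤ n := by
    simpa using K.finrank_le
  set e : Fin (Module.finrank ℝ K) ↪ Fin n := Fin.castLEEmb hr with he
  set bK := stdOrthonormalBasis ℝ K
  set v : Fin n → EuclideanSpace ℝ (Fin n) := Function.extend e (fun j => (bK j : EuclideanSpace ℝ (Fin n))) 0
  have hv : ∀ j, v (e j) = bK j := fun j => e.injective.extend_apply _ _ _
  have hon : Orthonormal ℝ ((Set.range e).domRestrict v) := by
    have h1 : Orthonormal ℝ (fun j => (bK j : EuclideanSpace ℝ (Fin n))) :=
      bK.orthonormal.comp_linearIsometry K.subtypeₗᵢ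
    have h2 := h1.comp (Equiv.ofInjective e e.injective).symm (Equiv.injective _)
    convert h2 using 1
    funext x
    obtain ⟨j, hj⟩ := (Equiv.ofInjective e e.injective).surjective x
    subst hj
    rw [Function.comp_apply, Equiv.symm_apply_apply]
    exact hv j
  obtain ⟨b, hb⟩ := hon.exists_orthonormalBasis_extension_of_card_eq (by simp)
  refine ⟨b, Finset.univ.map e, by simp, fun z => ?_⟩
  rw [Finset.sum_map]
  rw [Submodule.starProjection_apply, ← Submodule.coe_norm, ← bK.sum_sq_norm_inner_right]
  refine Finset.sum_congr rfl fun j _ => ?_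
  rw [OrthonormalBasis.repr_apply_apply, hb _ (Set.mem_range_self j), hv, Real.norm_eq_abs, sq_abs,
    Submodule.inner_orthogonalProjectionOnto_eq_of_mem_left]

/-- The Gaussian weight depends on the norm alone, so it is unchanged in coordinates adapted to `K`,
where the squared norm of the projection is a partial sum of squares. -/
theorem lintegral_inv_norm_sq_starProjection_mul_gaussWeight {n : ℕ}
    (K : Submodule ℝ (EuclideanSpace ℝ (Fin n))) (hK : 2 < Module.finrank ℝ K) :
    ∫⁻ z : Fin n → ℝ, (ENNReal.ofReal (‖K.starProjection (WithLp.toLp 2 z)‖ ^ 2))⁻¹ *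
        gaussWeight z =
      ENNReal.ofReal (1 / ((Module.finrank ℝ K : ℝ) - 2)) * ∫⁻ z : Fin n → ℝ, gaussWeight z := by
  obtain ⟨b, I, hI, hproj⟩ := exists_orthonormalBasis_norm_sq_starProjection K
  rw [← hI] at hK ⊢
  rw [← lintegral_inv_sum_sq_mul_gaussWeight I hK]
  set L : (Fin n → ℝ) ≃ₗ[ℝ] (Fin n → ℝ) := (WithLp.linearEquiv 2 ℝ (Fin n → ℝ)).symm ≪≫ₗ
    b.repr.toLinearEquiv ≪≫ₗ (WithLp.linearEquiv 2 ℝ (Fin n → ℝ)) with hL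
  have hLa : ∀ z i, L z i = b.repr (WithLp.toLp 2 z) i := fun z i => rfl
  have hLg : ∀ z, gaussWeight (L z) = gaussWeight z := by
    intro z
    simp only [gaussWeight, ← Finset.mul_sum, hLa]
    have h1 := EuclideanSpace.real_norm_sq_eq (b.repr (WithLp.toLp 2 z))
    have h2 := EuclideanSpace.real_norm_sq_eq (WithLp.toLp 2 z)
    rw [LinearIsometryEquiv.norm_map] at h1
    rw [← h1, h2]
  have hmp := measurePreserving_withDensity_of_comp_eq volume
    (measurable_gaussWeight (ι := Fin n)) L hLg
  have hm : Measurable fun z : Fin n → ℝ => (ENNReal.ofReal (∑ i ∈ I, z i ^ 2))⁻¹ := by fun_prop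
  have h := hmp.lintegral_comp hm
  rw [lintegral_withDensity_eq_lintegral_mul (g := fun z => (ENNReal.ofReal (∑ i ∈ I, L z i ^ 2))⁻¹)
    _ (by fun_prop) (hm.comp hmp.measurable),
    lintegral_withDensity_eq_lintegral_mul _ (by fun_prop) hm] at h
  simp only [Pi.mul_apply, hLa] at h
  simp only [hproj, mul_comm _ (gaussWeight _)]
  exact h

/-! ### Geometry of the columns of a sample. -/

/-- The `j`-th coordinates of a sample, as a vector of Euclidean space. -/
noncomputable def sampleCol {p n : ℕ} (y : Fin n → Fin p → ℝ) (j : Fin p) :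
    EuclideanSpace ℝ (Fin n) :=
  WithLp.toLp 2 fun a => y a j

/-- The vector all of whose coordinates are `1`. -/
noncomputable def onesVec (n : ℕ) : EuclideanSpace ℝ (Fin n) :=
  WithLp.toLp 2 fun _ => 1

/-- The columns of a sample, centered at their means. -/
noncomputable def centeredCol {p n : ℕ} (y : Fin n → Fin p → ℝ) (j : Fin p) :
    EuclideanSpace ℝ (Fin n) :=
  sampleCol y j - sampleMean y j • onesVec n

/-- The columns of a sample, with the `j`-th one replaced by the vector of ones. -/
noncomputable def replacedCol {p n : ℕ} (j : Fin p) (y : Fin n → Fin p → ℝ) :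
    Fin p → EuclideanSpace ℝ (Fin n) :=
  Function.update (sampleCol y) j (onesVec n)

/-- The span of the vector of ones and of all columns of a sample but the `j`-th one. -/
noncomputable def otherSpan {p n : ℕ} (j : Fin p) (y : Fin n → Fin p → ℝ) :
    Submodule ℝ (EuclideanSpace ℝ (Fin n)) :=
  Submodule.span ℝ (Set.range (replacedCol j y))

section

variable {p n : ℕ} (y : Fin n → Fin p → ℝ)

theorem onesVec_mem_otherSpan (j : Fin p) : onesVec n ∈ otherSpan j y :=
  Submodule.subset_span ⟨j, by simp [replacedCol]⟩

theorem sampleCol_mem_otherSpan {j k : Fin p} (h : k ≠ j) : sampleCol y k ∈ otherSpan j y :=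
  Submodule.subset_span ⟨k, by simp [replacedCol, h]⟩

theorem centeredCol_mem_otherSpan {j k : Fin p} (h : k ≠ j) : centeredCol y k ∈ otherSpan j y :=
  sub_mem (sampleCol_mem_otherSpan y h) (Submodule.smul_mem _ _ (onesVec_mem_otherSpan y j))

theorem sspMatrix_eq_gram : sspMatrix y = Matrix.gram ℝ (centeredCol y) := by
  ext i j
  rw [Matrix.gram_apply, sspMatrix, Matrix.sum_apply, PiLp.inner_apply]
  refine Finset.sum_congr rfl fun a _ => ?_
  simp [Matrix.vecMulVec_apply, centeredCol, sampleCol, onesVec, mul_comm]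

theorem inner_onesVec_centeredCol (hn : n ≠ 0) (j : Fin p) :
    inner ℝ (onesVec n) (centeredCol y j) = 0 := by
  rw [PiLp.inner_apply]
  have : (n : ℝ) ≠ 0 := Nat.cast_ne_zero.2 hn
  simp [centeredCol, sampleCol, onesVec, sampleMean, Finset.sum_sub_distrib]
  field_simp
  simp

variable {y}

/-- A Gram matrix is positive definite when its vectors are independent; a relation among centered
columns would put some column in the span of the ones vector and the others. -/
theorem posDef_sspMatrix (h : ∀ j, sampleCol y j ∉ otherSpan j y) : (sspMatrix y).PosDef := by
  rw [sspMatrix_eq_gram]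
  refine Matrix.posDef_gram_of_linearIndependent ?_
  rw [linearIndependent_iff_notMem_span]
  intro j hj
  refine h j ?_
  have hle : Submodule.span ℝ (centeredCol y '' (Set.univ \ {j})) ≤ otherSpan j y := by
    rw [Submodule.span_le]
    rintro _ ⟨k, hk, rfl⟩
    exact centeredCol_mem_otherSpan y (by simpa using hk)
  have := add_mem (hle hj) (Submodule.smul_mem _ (sampleMean y j) (onesVec_mem_otherSpan y j))
  simpa [centeredCol] using this

/-- In a relation among the ones vector and the other columns, a nonzero coefficient of column `i`
would put that column in its own `otherSpan i`. Only the ones vector is then left, and it is nonzero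
since `n ≠ 0`. -/
theorem finrank_otherSpan (hn : n ≠ 0) (h : ∀ j, sampleCol y j ∉ otherSpan j y) (j : Fin p) :
    Module.finrank ℝ (otherSpan j y) = p := by
  have hli : LinearIndependent ℝ (replacedCol j y) := by
    rw [Fintype.linearIndependent_iff]
    intro g hg
    have h1 : ∀ i, i ≠ j → g i = 0 := by
      intro i hi
      by_contra hgi
      refine h i ?_
      rw [← Finset.add_sum_erase _ _ (Finset.mem_univ i)] at hg
      have h2 : g i • sampleCol y i = -∑ k ∈ Finset.univ.erase i, g k • replacedCol j y k := by
        rw [← add_eq_zero_iff_eq_neg, ← hg, replacedCol, Function.update_of_ne hi]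
      have h3 : g i • sampleCol y i ∈ otherSpan i y := by
        rw [h2]
        refine neg_mem (sum_mem fun k hk => Submodule.smul_mem _ _ ?_)
        by_cases hkj : k = j
        · subst hkj
          simpa [replacedCol] using onesVec_mem_otherSpan y i
        · rw [replacedCol, Function.update_of_ne hkj]
          exact sampleCol_mem_otherSpan y (Finset.ne_of_mem_erase hk)
      exact (Submodule.smul_mem_iff _ hgi).1 h3
    have h2 : g j = 0 := by
      rw [Finset.sum_eq_single j (fun i _ hi => by rw [h1 i hi, zero_smul]) (by simp)] at hg
      have h3 := congrArg (fun v : EuclideanSpace ℝ (Fin n) => v ⟨0, Nat.pos_of_ne_zero hn⟩) hg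
      simpa [replacedCol, onesVec] using h3
    intro i
    by_cases hi : i = j
    · rw [hi, h2]
    · exact h1 i hi
  rw [otherSpan, finrank_span_eq_card hli, Fintype.card_fin]

/-- A diagonal entry of the inverse is the inverse of the squared distance of a column to the span
of the vector of ones and the other columns. -/
theorem inv_sspMatrix_apply_self (hn : n ≠ 0) (h : ∀ j, sampleCol y j ∉ otherSpan j y) (j : Fin p) :
    ENNReal.ofReal ((sspMatrix y)⁻¹ j j) =
      (ENNReal.ofReal (‖(otherSpan j y)ᗮ.starProjection (sampleCol y j)‖ ^ 2))⁻¹ := by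
  have hW := posDef_sspMatrix h
  have hdet : IsUnit (sspMatrix y).det := hW.det_pos.ne'.isUnit
  set w : Fin p → ℝ := fun i => (sspMatrix y)⁻¹ i j with hw
  -- `ζ` is the dual vector of column `j`: it pairs to `1` with that column and is orthogonal to
  -- `otherSpan j y`. Projecting its expansion onto the orthogonal complement leaves only the `j`-th
  -- term, so `ζ` is `w j` times the projected column; pairing with the column gives `w j *
  -- distance² = 1`.
  set ζ : EuclideanSpace ℝ (Fin n) := ∑ i, w i • centeredCol y i with hζ
  have h1 : ∀ i, inner ℝ (centeredCol y i) ζ = if i = j then 1 else 0 := by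
    intro i
    have h2 := congrFun (congrFun (Matrix.mul_nonsing_inv _ hdet) i) j
    rw [Matrix.mul_apply, Matrix.one_apply] at h2
    rw [← h2, hζ, inner_sum]
    refine Finset.sum_congr rfl fun k _ => ?_
    rw [inner_smul_right, sspMatrix_eq_gram, Matrix.gram_apply, mul_comm, hw, sspMatrix_eq_gram]
  have h2 : inner ℝ (onesVec n) ζ = 0 := by
    rw [hζ, inner_sum]
    exact Finset.sum_eq_zero fun i _ => by
      rw [inner_smul_right, inner_onesVec_centeredCol y hn, mul_zero]
  have h3 : ∀ i, inner ℝ (sampleCol y i) ζ = if i = j then 1 else 0 := by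
    intro i
    rw [← h1 i, centeredCol, inner_sub_left, inner_smul_left, h2, mul_zero, sub_zero]
  have hmem : ζ ∈ (otherSpan j y)ᗮ := by
    rw [Submodule.mem_orthogonal]
    intro u hu
    induction hu using Submodule.span_induction with
    | mem u hu =>
      obtain ⟨k, rfl⟩ := hu
      by_cases hkj : k = j
      · subst hkj
        simpa [replacedCol] using h2
      · rw [replacedCol, Function.update_of_ne hkj, h3, if_neg hkj]
    | zero => simp
    | add u v _ _ hu hv => rw [inner_add_left, hu, hv, add_zero]
    | smul c u _ hu => rw [inner_smul_left, hu, mul_zero]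
  set K := (otherSpan j y)ᗮ with hK
  have hz : ∀ v ∈ otherSpan j y, K.starProjection v = 0 := fun v hv =>
    K.starProjection_apply_eq_zero_iff.2 (Submodule.le_orthogonal_orthogonal _ hv)
  have h4 : ζ = w j • K.starProjection (sampleCol y j) := by
    have h5 : K.starProjection ζ = ζ := K.starProjection_eq_self_iff.2 hmem
    rw [← h5, hζ, map_sum, Finset.sum_eq_single j]
    · rw [map_smul, centeredCol, map_sub, map_smul, hz _ (onesVec_mem_otherSpan y j), smul_zero,
        sub_zero]
    · intro i _ hi
      rw [map_smul, hz _ (centeredCol_mem_otherSpan y hi), smul_zero]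
    · simp
  have h6 : w j * ‖K.starProjection (sampleCol y j)‖ ^ 2 = 1 := by
    have h7 : inner ℝ (K.starProjection (sampleCol y j)) ζ = 1 := by
      rw [K.inner_starProjection_left_eq_right, K.starProjection_eq_self_iff.2 hmem, h3, if_pos rfl]
    rw [h4, inner_smul_right, real_inner_self_eq_norm_sq] at h7
    exact h7
  have h8 : 0 < ‖K.starProjection (sampleCol y j)‖ ^ 2 := by
    refine lt_of_le_of_ne (by positivity) fun h0 => ?_
    rw [← h0, mul_zero] at h6
    exact zero_ne_one h6
  rw [← ENNReal.ofReal_inv_of_pos h8]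
  congr 1
  exact eq_inv_of_mul_eq_one_left h6

end

/-! ### Measurability of membership in a varying span. -/

/-- The span is closed and rational combinations are dense in it. Membership thus becomes a
countable combination of open conditions, which makes the set of degenerate samples measurable. -/
theorem mem_span_range_iff_forall_exists_rat {E ι : Type*} [Fintype ι] [NormedAddCommGroup E]
    [NormedSpace ℝ E] [FiniteDimensional ℝ E] (u : ι → E) (v : E) :
    v ∈ Submodule.span ℝ (Set.range u) ↔
      ∀ m : ℕ, ∃ q : ι → ℚ, ‖v - ∑ k, (q k : ℝ) • u k‖ < 1 / ((m : ℝ) + 1) := by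
  constructor
  · intro h m
    obtain ⟨c, hc⟩ := (Submodule.mem_span_range_iff_exists_fun ℝ).1 h
    have hdense : DenseRange (fun (q : ι → ℚ) (k : ι) => (q k : ℝ)) :=
      DenseRange.piMap fun _ => Rat.denseRange_cast
    have hcont : Continuous fun g : ι → ℝ => ‖v - ∑ k, g k • u k‖ := by fun_prop
    have hopen : IsOpen {g : ι → ℝ | ‖v - ∑ k, g k • u k‖ < 1 / ((m : ℝ) + 1)} :=
      isOpen_lt hcont continuous_const
    obtain ⟨q, hq⟩ := hdense.exists_mem_open hopen ⟨c, by
      show ‖v - ∑ k, c k • u k‖ < 1 / ((m : ℝ) + 1)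
      rw [hc, sub_self, norm_zero]
      positivity⟩
    exact ⟨q, hq⟩
  · intro h
    have hcl : IsClosed (Submodule.span ℝ (Set.range u) : Set E) :=
      Submodule.closed_of_finiteDimensional _
    rw [← SetLike.mem_coe, ← hcl.closure_eq, Metric.mem_closure_iff]
    intro ε hε
    obtain ⟨m, hm⟩ := exists_nat_one_div_lt hε
    obtain ⟨q, hq⟩ := h m
    refine ⟨_, ?_, (dist_eq_norm _ _).trans_lt (hq.trans hm)⟩
    exact sum_mem fun k _ => Submodule.smul_mem _ _ (Submodule.subset_span ⟨k, rfl⟩)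

theorem measurableSet_mem_span_range {X E ι : Type*} [Fintype ι] [NormedAddCommGroup E]
    [NormedSpace ℝ E] [FiniteDimensional ℝ E] [TopologicalSpace X] [MeasurableSpace X]
    [OpensMeasurableSpace X] {u : X → ι → E} {v : X → E} (hu : ∀ k, Continuous fun x => u x k)
    (hv : Continuous v) :
    MeasurableSet {x | v x ∈ Submodule.span ℝ (Set.range (u x))} := by
  simp only [mem_span_range_iff_forall_exists_rat]
  rw [Set.ofPred_forall]
  refine MeasurableSet.iInter fun m => ?_
  rw [Set.ofPred_exists]
  refine MeasurableSet.iUnion fun q => ?_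
  exact (isOpen_lt (by fun_prop) continuous_const).measurableSet

/-! ### Gaussian samples and the resampling of a column. -/

instance isAddHaarMeasure_volume_pi_pi {p n : ℕ} :
    (volume : Measure (Fin n → Fin p → ℝ)).IsAddHaarMeasure :=
  Measure.pi.isAddHaarMeasure fun _ => (volume : Measure (Fin p → ℝ))

/-- The unnormalized standard Gaussian density of a sample. -/
noncomputable def sampleGaussWeight {p n : ℕ} (y : Fin n → Fin p → ℝ) : ℝ≥0∞ :=
  ENNReal.ofReal (Real.exp (-∑ a, ∑ i, 1 / 2 * y a i ^ 2))

@[fun_prop]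
theorem measurable_sampleGaussWeight {p n : ℕ} :
    Measurable (sampleGaussWeight : (Fin n → Fin p → ℝ) → ℝ≥0∞) := by
  unfold sampleGaussWeight
  fun_prop

instance isFiniteMeasure_sampleGaussWeight {p n : ℕ} :
    IsFiniteMeasure ((volume : Measure (Fin n → Fin p → ℝ)).withDensity sampleGaussWeight) := by
  refine isFiniteMeasure_withDensity ?_
  have h1 : Integrable (fun z : Fin p → ℝ => ∏ i, Real.exp (-(1 / 2) * z i ^ 2)) :=
    Integrable.fintype_prod (f := fun _ x => Real.exp (-(1 / 2) * x ^ 2))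
      fun _ => integrable_exp_neg_mul_sq (by norm_num)
  have h2 : Integrable (fun y : Fin n → Fin p → ℝ => ∏ a, ∏ i, Real.exp (-(1 / 2) * y a i ^ 2)) :=
    Integrable.fintype_prod (f := fun _ (z : Fin p → ℝ) => ∏ i, Real.exp (-(1 / 2) * z i ^ 2))
      fun _ => h1
  have h3 : ∀ y : Fin n → Fin p → ℝ, sampleGaussWeight y =
      ENNReal.ofReal (∏ a, ∏ i, Real.exp (-(1 / 2) * y a i ^ 2)) := by
    intro y
    simp only [sampleGaussWeight, ← Real.exp_sum, ← Finset.sum_neg_distrib, neg_mul]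
  simp only [h3]
  exact h2.lintegral_lt_top.ne

/-- Replace the `j`-th coordinates of a sample. -/
def replaceCol {p n : ℕ} (j : Fin p) (y : Fin n → Fin p → ℝ) (z : Fin n → ℝ) :
    Fin n → Fin p → ℝ :=
  fun a => Function.update (y a) j (z a)

/-- Exchange the `j`-th coordinates of a sample with a vector. -/
def swapCol {p n : ℕ} (j : Fin p) :
    ((Fin n → Fin p → ℝ) × (Fin n → ℝ)) ≃ₗ[ℝ] ((Fin n → Fin p → ℝ) × (Fin n → ℝ)) where
  toFun q := (replaceCol j q.1 q.2, fun a => q.1 a j)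
  invFun q := (replaceCol j q.1 q.2, fun a => q.1 a j)
  map_add' q q' := by
    ext a i
    · by_cases h : i = j
      · subst h; simp [replaceCol]
      · simp [replaceCol, h]
    · simp
  map_smul' c q := by
    ext a i
    · by_cases h : i = j
      · subst h; simp [replaceCol]
      · simp [replaceCol, h]
    · simp
  left_inv q := by
    ext a i
    · by_cases h : i = j
      · subst h; simp [replaceCol]
      · simp [replaceCol, h]
    · simp [replaceCol]
  right_inv q := by
    ext a i
    · by_cases h : i = j
      · subst h; simp [replaceCol]
      · simp [replaceCol, h]
    · simp [replaceCol]

theorem sampleGaussWeight_replaceCol_mul {p n : ℕ} (j : Fin p) (y : Fin n → Fin p → ℝ)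
    (z : Fin n → ℝ) :
    sampleGaussWeight (replaceCol j y z) * gaussWeight (fun a => y a j) =
      sampleGaussWeight y * gaussWeight z := by
  simp only [sampleGaussWeight, gaussWeight]
  rw [← ENNReal.ofReal_mul (by positivity), ← ENNReal.ofReal_mul (by positivity), ← Real.exp_add,
    ← Real.exp_add, ← neg_add, ← neg_add, ← Finset.sum_add_distrib, ← Finset.sum_add_distrib]
  congr 3
  refine Finset.sum_congr rfl fun a _ => ?_
  rw [← Finset.add_sum_erase _ (fun i => 1 / 2 * replaceCol j y z a i ^ 2) (Finset.mem_univ j),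
    ← Finset.add_sum_erase _ (fun i => 1 / 2 * y a i ^ 2) (Finset.mem_univ j)]
  have : ∑ i ∈ Finset.univ.erase j, 1 / 2 * replaceCol j y z a i ^ 2 =
      ∑ i ∈ Finset.univ.erase j, 1 / 2 * y a i ^ 2 :=
    Finset.sum_congr rfl fun i hi => by
      rw [replaceCol, Function.update_of_ne (Finset.ne_of_mem_erase hi)]
  rw [this, replaceCol, Function.update_self]
  ring

/-- Resampling one column of a Gaussian sample does not change its law. -/
theorem lintegral_sampleGaussWeight_replaceCol {p n : ℕ} (j : Fin p)
    {F : (Fin n → Fin p → ℝ) → ℝ≥0∞} (hF : Measurable F) :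
    (∫⁻ y, F y * sampleGaussWeight y) * (∫⁻ z : Fin n → ℝ, gaussWeight z) =
      ∫⁻ y, (∫⁻ z : Fin n → ℝ, F (replaceCol j y z) * gaussWeight z) * sampleGaussWeight y := by
  set f : (Fin n → Fin p → ℝ) × (Fin n → ℝ) → ℝ≥0∞ :=
    fun q => sampleGaussWeight q.1 * gaussWeight q.2 with hf
  have hfm : Measurable f := by fun_prop
  have hprod : ((volume : Measure (Fin n → Fin p → ℝ)).withDensity sampleGaussWeight).prod
      ((volume : Measure (Fin n → ℝ)).withDensity gaussWeight) =
      (Measure.prod volume volume).withDensity f := by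
    rw [prod_withDensity (by fun_prop) (by fun_prop)]
  have : IsFiniteMeasure (((volume : Measure (Fin n → Fin p → ℝ)).prod
      (volume : Measure (Fin n → ℝ))).withDensity f) := by
    rw [← hprod]
    infer_instance
  have : ((volume : Measure (Fin n → Fin p → ℝ)).prod
      (volume : Measure (Fin n → ℝ))).IsAddHaarMeasure := Measure.prod.instIsAddHaarMeasure _ _
  -- The exchange of a column with an independent Gaussian vector is linear and keeps the joint
  -- weight, hence preserves the joint law.
  have hmp := measurePreserving_withDensity_of_comp_eq (Measure.prod volume volume) hfm (swapCol (n := n) j)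
    (fun q => sampleGaussWeight_replaceCol_mul j q.1 q.2)
  have hm : Measurable fun q : (Fin n → Fin p → ℝ) × (Fin n → ℝ) => F q.1 := by fun_prop
  have hm' : Measurable fun q : (Fin n → Fin p → ℝ) × (Fin n → ℝ) => F (replaceCol j q.1 q.2) :=
    hm.comp hmp.measurable
  have h := hmp.lintegral_comp hm
  rw [lintegral_withDensity_eq_lintegral_mul (g := fun q => F (swapCol j q).1) _ hfm
    (hm.comp hmp.measurable), lintegral_withDensity_eq_lintegral_mul _ hfm hm,
    lintegral_prod _ (hfm.mul hm).aemeasurable] at h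
  replace h := (lintegral_prod _ (hfm.mul hm').aemeasurable).symm.trans h
  simp only [Pi.mul_apply, hf] at h
  rw [← lintegral_mul_const _ (by fun_prop)]
  calc _ = ∫⁻ y, ∫⁻ z, sampleGaussWeight y * gaussWeight z * F y := by
        refine lintegral_congr fun y => ?_
        rw [← lintegral_const_mul _ (by fun_prop)]
        refine lintegral_congr fun z => ?_
        ring
    _ = _ := h.symm
    _ = _ := by
        refine lintegral_congr fun y => ?_
        have hz : Measurable fun z => F (replaceCol j y z) * gaussWeight z :=
          (hm'.comp measurable_prodMk_left).mul measurable_gaussWeight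
        rw [← lintegral_mul_const _ hz]
        refine lintegral_congr fun z => ?_
        show _ * F (replaceCol j y z) = _
        ring

theorem otherSpan_replaceCol {p n : ℕ} (j : Fin p) (y : Fin n → Fin p → ℝ) (z : Fin n → ℝ) :
    otherSpan j (replaceCol j y z) = otherSpan j y := by
  have : replacedCol j (replaceCol j y z) = replacedCol j y := by
    funext k
    by_cases hk : k = j
    · subst hk; simp [replacedCol]
    · simp only [replacedCol, Function.update_of_ne hk, sampleCol, replaceCol]
  rw [otherSpan, otherSpan, this]

theorem sampleCol_replaceCol {p n : ℕ} (j : Fin p) (y : Fin n → Fin p → ℝ) (z : Fin n → ℝ) :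
    sampleCol (replaceCol j y z) j = WithLp.toLp 2 z := by
  simp [sampleCol, replaceCol]

theorem lintegral_gaussWeight_pos {ι : Type*} [Fintype ι] :
    ∫⁻ z : ι → ℝ, gaussWeight z ≠ 0 := by
  rw [lintegral_gaussWeight, ne_eq, ENNReal.ofReal_eq_zero, not_le]
  exact Finset.prod_pos fun _ _ => Real.sqrt_pos.2 (by positivity)

theorem lintegral_gaussWeight_ne_top {ι : Type*} [Fintype ι] :
    ∫⁻ z : ι → ℝ, gaussWeight z ≠ ∞ := by
  rw [lintegral_gaussWeight]
  exact ENNReal.ofReal_ne_top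

theorem measurableSet_sampleCol_mem_otherSpan {p n : ℕ} (j : Fin p) :
    MeasurableSet {y : Fin n → Fin p → ℝ | sampleCol y j ∈ otherSpan j y} := by
  have hc : ∀ k, Continuous fun y : Fin n → Fin p → ℝ => sampleCol y k := by
    intro k
    unfold sampleCol
    fun_prop
  refine measurableSet_mem_span_range (fun k => ?_) (hc j)
  by_cases hk : k = j
  · subst hk
    simp only [replacedCol, Function.update_self]
    exact continuous_const
  · simp only [replacedCol, Function.update_of_ne hk]
    exact hc k

/-- Resample column `j` with the others fixed: `otherSpan j y` has dimension at most `p < n`, so it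
is a null set for the new column. The Gaussian weight is everywhere positive, so a Gaussian-null set
is Lebesgue-null. -/
theorem ae_sampleCol_notMem_otherSpan {p n : ℕ} (hpn : p < n) :
    ∀ᵐ y : Fin n → Fin p → ℝ, ∀ j, sampleCol y j ∉ otherSpan j y := by
  rw [ae_all_iff]
  intro j
  have hB := measurableSet_sampleCol_mem_otherSpan (n := n) j
  set B := {y : Fin n → Fin p → ℝ | sampleCol y j ∈ otherSpan j y} with hBdef
  have h := lintegral_sampleGaussWeight_replaceCol j (F := B.indicator 1)
    (measurable_one.indicator hB)
  have h0 : ∀ y : Fin n → Fin p → ℝ,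
      ∫⁻ z : Fin n → ℝ, B.indicator 1 (replaceCol j y z) * gaussWeight z = 0 := by
    intro y
    set V : Submodule ℝ (Fin n → ℝ) :=
      (otherSpan j y).comap (WithLp.linearEquiv 2 ℝ (Fin n → ℝ)).symm.toLinearMap with hV
    have hVtop : V ≠ ⊤ := by
      intro htop
      have h1 : otherSpan j y = ⊤ := by
        rw [eq_top_iff]
        intro x _
        have : WithLp.ofLp x ∈ V := htop ▸ Submodule.mem_top
        simpa [hV] using this
      have h2 : Module.finrank ℝ (otherSpan j y) ≤ p := by
        have := finrank_range_le_card (R := ℝ) (replacedCol j y)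
        rwa [Fintype.card_fin] at this
      rw [h1, finrank_top, finrank_euclideanSpace_fin] at h2
      omega
    have hae : ∀ᵐ z : Fin n → ℝ, z ∉ V :=
      measure_eq_zero_iff_ae_notMem.1 (Measure.addHaar_submodule volume V hVtop)
    rw [lintegral_congr_ae (g := fun _ => 0), lintegral_zero]
    filter_upwards [hae] with z hz
    have hz' : replaceCol j y z ∉ B := by
      intro hmem
      have hmem : sampleCol (replaceCol j y z) j ∈ otherSpan j (replaceCol j y z) := hmem
      rw [otherSpan_replaceCol, sampleCol_replaceCol] at hmem
      exact hz hmem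
    rw [Set.indicator_of_notMem hz', zero_mul]
  simp only [h0, zero_mul, lintegral_zero] at h
  have h1 := (mul_eq_zero.1 h).resolve_right lintegral_gaussWeight_pos
  have hBm : Measurable fun y : Fin n → Fin p → ℝ =>
      B.indicator (1 : (Fin n → Fin p → ℝ) → ℝ≥0∞) y * sampleGaussWeight y :=
    (measurable_one.indicator hB).mul (by fun_prop)
  rw [lintegral_eq_zero_iff hBm] at h1
  filter_upwards [h1] with y hy hmem
  have hyB : y ∈ B := hmem
  rw [Set.indicator_of_mem hyB] at hy
  simp only [Pi.one_apply, one_mul, Pi.zero_apply, sampleGaussWeight, ENNReal.ofReal_eq_zero] at hy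
  exact absurd hy (not_le.2 (Real.exp_pos _))

theorem continuous_sspMatrix {p n : ℕ} :
    Continuous (sspMatrix : (Fin n → Fin p → ℝ) → Matrix (Fin p) (Fin p) ℝ) := by
  unfold sspMatrix sampleMean
  refine continuous_matrix fun i j => ?_
  simp only [Matrix.sum_apply, Matrix.vecMulVec_apply]
  fun_prop

theorem measurable_inv_sspMatrix {p n : ℕ} (i j : Fin p) :
    Measurable fun y : Fin n → Fin p → ℝ => (sspMatrix y)⁻¹ i j := by
  have hdet : Continuous fun y : Fin n → Fin p → ℝ => (sspMatrix y).det := continuous_sspMatrix.matrix_det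
  have hadj : Continuous fun y : Fin n → Fin p → ℝ => (sspMatrix y).adjugate i j :=
    continuous_sspMatrix.matrix_adjugate.matrix_elem i j
  simp only [Matrix.inv_def, Matrix.smul_apply, smul_eq_mul, Ring.inverse_eq_inv']
  exact hdet.measurable.inv.mul hadj.measurable

/-- The mean of a diagonal entry of the inverse for a Gaussian sample. -/
theorem lintegral_inv_sspMatrix_mul_sampleGaussWeight {p n : ℕ} (hn : p + 2 < n) (j : Fin p) :
    ∫⁻ y : Fin n → Fin p → ℝ, ENNReal.ofReal ((sspMatrix y)⁻¹ j j) * sampleGaussWeight y =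
      ENNReal.ofReal (1 / ((n : ℝ) - p - 2)) *
        ∫⁻ y : Fin n → Fin p → ℝ, sampleGaussWeight y := by
  have hm : Measurable fun y : Fin n → Fin p → ℝ => ENNReal.ofReal ((sspMatrix y)⁻¹ j j) :=
    (measurable_inv_sspMatrix j j).ennreal_ofReal
  have h := lintegral_sampleGaussWeight_replaceCol j hm
  set G : Set (Fin n → Fin p → ℝ) := {y | ∀ j, sampleCol y j ∉ otherSpan j y} with hG
  have hGm : MeasurableSet G := by
    rw [hG, Set.ofPred_forall]
    exact MeasurableSet.iInter fun k => (measurableSet_sampleCol_mem_otherSpan k).compl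
  have hae : ∀ᵐ y : Fin n → Fin p → ℝ, y ∈ G := ae_sampleCol_notMem_otherSpan (by omega)
  -- Resampling applied to the indicator of the degenerate samples: for almost every `y`, almost
  -- every new column keeps the sample in `G`.
  have hae2 : ∀ᵐ y : Fin n → Fin p → ℝ, ∀ᵐ z : Fin n → ℝ, replaceCol j y z ∈ G := by
    have h2 := lintegral_sampleGaussWeight_replaceCol j (F := Gᶜ.indicator 1)
      (measurable_one.indicator hGm.compl)
    have h3 : ∫⁻ y, Gᶜ.indicator 1 y * sampleGaussWeight y = 0 := by
      rw [lintegral_congr_ae (g := fun _ => 0), lintegral_zero]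
      filter_upwards [hae] with y hy
      rw [Set.indicator_of_notMem (by simpa using hy), zero_mul]
    have hmr : Measurable fun q : (Fin n → Fin p → ℝ) × (Fin n → ℝ) => replaceCol j q.1 q.2 :=
      ((swapCol (n := n) j).toLinearMap.continuous_of_finiteDimensional.measurable).fst
    have hmi : Measurable fun q : (Fin n → Fin p → ℝ) × (Fin n → ℝ) =>
        Gᶜ.indicator (1 : (Fin n → Fin p → ℝ) → ℝ≥0∞) (replaceCol j q.1 q.2) * gaussWeight q.2 :=
      ((measurable_one.indicator hGm.compl).comp hmr).mul (by fun_prop)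
    have hmo : Measurable fun y : Fin n → Fin p → ℝ => (∫⁻ z : Fin n → ℝ,
        Gᶜ.indicator (1 : (Fin n → Fin p → ℝ) → ℝ≥0∞) (replaceCol j y z) * gaussWeight z) *
          sampleGaussWeight y :=
      hmi.lintegral_prod_right'.mul (by fun_prop)
    rw [h3, zero_mul, eq_comm, lintegral_eq_zero_iff hmo] at h2
    filter_upwards [h2] with y hy
    have hy' := (mul_eq_zero.1 hy).resolve_right
      (by simpa [sampleGaussWeight] using Real.exp_pos _)
    have hmz := hmi.comp (measurable_prodMk_left (x := y))
    simp only [Function.comp_def] at hmz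
    rw [lintegral_eq_zero_iff hmz] at hy'
    filter_upwards [hy'] with z hz
    by_contra hzG
    have hzG : replaceCol j y z ∈ Gᶜ := hzG
    have hz : Gᶜ.indicator (1 : (Fin n → Fin p → ℝ) → ℝ≥0∞) (replaceCol j y z) *
      gaussWeight z = 0 := hz
    rw [Set.indicator_of_mem hzG, Pi.one_apply, one_mul, gaussWeight, ENNReal.ofReal_eq_zero] at hz
    exact absurd hz (not_le.2 (Real.exp_pos _))
  -- With the other columns fixed, the entry is the inverse squared norm of the projection of a
  -- Gaussian vector onto a space of dimension `n - p`.
  have hin : ∀ᵐ y : Fin n → Fin p → ℝ,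
      (∫⁻ z : Fin n → ℝ, ENNReal.ofReal ((sspMatrix (replaceCol j y z))⁻¹ j j) * gaussWeight z) *
        sampleGaussWeight y =
      ENNReal.ofReal (1 / ((n : ℝ) - p - 2)) * (∫⁻ z : Fin n → ℝ, gaussWeight z) *
        sampleGaussWeight y := by
    filter_upwards [hae, hae2] with y hy hz
    congr 1
    have hdim : Module.finrank ℝ (otherSpan j y)ᗮ = n - p := by
      have h1 := (otherSpan j y).finrank_add_finrank_orthogonal
      rw [finrank_otherSpan (by omega) hy j, finrank_euclideanSpace_fin] at h1
      omega
    have hproj := lintegral_inv_norm_sq_starProjection_mul_gaussWeight (otherSpan j y)ᗮ (by omega)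
    rw [hdim, Nat.cast_sub (by omega)] at hproj
    rw [← hproj]
    refine lintegral_congr_ae ?_
    filter_upwards [hz] with z hz
    rw [inv_sspMatrix_apply_self (by omega) hz j, otherSpan_replaceCol, sampleCol_replaceCol]
  rw [lintegral_congr_ae hin, lintegral_const_mul _ (by fun_prop), mul_right_comm] at h
  exact (ENNReal.mul_left_inj lintegral_gaussWeight_pos lintegral_gaussWeight_ne_top).1 h

/-! ### Radial densities: from the Gaussian to the Kotz case. -/

/-- The sum of the squares of all coordinates of a sample. -/
def sampleNormSq {p n : ℕ} (y : Fin n → Fin p → ℝ) : ℝ :=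
  ∑ a, ∑ i, y a i ^ 2

theorem continuous_sampleNormSq {p n : ℕ} :
    Continuous (sampleNormSq : (Fin n → Fin p → ℝ) → ℝ) := by
  unfold sampleNormSq
  fun_prop

@[fun_prop]
theorem measurable_sampleNormSq {p n : ℕ} :
    Measurable (sampleNormSq : (Fin n → Fin p → ℝ) → ℝ) :=
  continuous_sampleNormSq.measurable

theorem sampleNormSq_nonneg {p n : ℕ} (y : Fin n → Fin p → ℝ) : 0 ≤ sampleNormSq y :=
  Finset.sum_nonneg fun _ _ => Finset.sum_nonneg fun _ _ => sq_nonneg _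

theorem sq_le_sampleNormSq {p n : ℕ} (y : Fin n → Fin p → ℝ) (a : Fin n) (i : Fin p) :
    y a i ^ 2 ≤ sampleNormSq y :=
  (Finset.single_le_sum (f := fun i => y a i ^ 2) (fun _ _ => sq_nonneg _)
    (Finset.mem_univ i)).trans
    (Finset.single_le_sum (f := fun a => ∑ i, y a i ^ 2)
      (fun _ _ => Finset.sum_nonneg fun _ _ => sq_nonneg _) (Finset.mem_univ a))

theorem sampleNormSq_pos {p n : ℕ} {y : Fin n → Fin p → ℝ} (hy : y ≠ 0) : 0 < sampleNormSq y := by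
  by_contra h
  refine hy ?_
  ext a i
  have := (sq_le_sampleNormSq y a i).trans (not_lt.1 h)
  simpa using pow_eq_zero_iff two_ne_zero |>.1 (le_antisymm this (sq_nonneg _))

theorem sampleNormSq_smul {p n : ℕ} (r : ℝ) (y : Fin n → Fin p → ℝ) :
    sampleNormSq (r • y) = r ^ 2 * sampleNormSq y := by
  simp only [sampleNormSq, Pi.smul_apply, smul_eq_mul, mul_pow, Finset.mul_sum]

theorem sampleMean_add_mulVec {p n : ℕ} (hn : n ≠ 0) (m : Fin p → ℝ)
    (T : Matrix (Fin p) (Fin p) ℝ) (y : Fin n → Fin p → ℝ) :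
    sampleMean (fun a => m + T.mulVec (y a)) = m + T.mulVec (sampleMean y) := by
  have hn' : (n : ℝ) ≠ 0 := Nat.cast_ne_zero.2 hn
  rw [sampleMean, sampleMean, Finset.sum_add_distrib, Matrix.mulVec_smul, Matrix.mulVec_sum,
    smul_add, Finset.sum_const, Finset.card_univ, Fintype.card_fin, ← Nat.cast_smul_eq_nsmul ℝ,
    smul_smul, inv_mul_cancel₀ hn', one_smul]

theorem sspMatrix_add_mulVec {p n : ℕ} (hn : n ≠ 0) (m : Fin p → ℝ)
    (T : Matrix (Fin p) (Fin p) ℝ) (y : Fin n → Fin p → ℝ) :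
    sspMatrix (fun a => m + T.mulVec (y a)) = T * sspMatrix y * T.transpose := by
  rw [sspMatrix, sampleMean_add_mulVec hn, sspMatrix, Finset.mul_sum, Finset.sum_mul]
  refine Finset.sum_congr rfl fun a _ => ?_
  rw [add_sub_add_left_eq_sub, ← Matrix.mulVec_sub, Matrix.mul_vecMulVec, Matrix.vecMulVec_mul,
    Matrix.vecMul_transpose]

theorem inv_sspMatrix_smul {p n : ℕ} (hn : n ≠ 0) {r : ℝ} (hr : 0 < r) (y : Fin n → Fin p → ℝ) :
    (sspMatrix (r • y))⁻¹ = (r ^ 2)⁻¹ • (sspMatrix y)⁻¹ := by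
  have h := sspMatrix_add_mulVec hn 0 (r • (1 : Matrix (Fin p) (Fin p) ℝ)) y
  have h1 : (fun a => 0 + (r • (1 : Matrix (Fin p) (Fin p) ℝ)).mulVec (y a)) = r • y := by
    funext a
    rw [zero_add, Matrix.smul_mulVec, Matrix.one_mulVec, Pi.smul_apply]
  rw [h1] at h
  have hinv : (r • (1 : Matrix (Fin p) (Fin p) ℝ))⁻¹ = r⁻¹ • 1 :=
    Matrix.inv_eq_right_inv (by simp [smul_smul, hr.ne'])
  rw [h, Matrix.mul_inv_rev, Matrix.mul_inv_rev, Matrix.transpose_smul, Matrix.transpose_one, hinv]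
  simp [smul_smul, sq]

/-- The density of a standard Kotz-type sample, up to a constant factor. -/
noncomputable def kotzRadial (q θ s z : ℝ) : ℝ≥0∞ :=
  ENNReal.ofReal (z ^ (q - 1) * Real.exp (-θ * z ^ s))

@[fun_prop]
theorem measurable_kotzRadial (q θ s : ℝ) : Measurable (kotzRadial q θ s) := by
  unfold kotzRadial
  fun_prop

theorem sampleGaussWeight_eq_kotzRadial {p n : ℕ} (y : Fin n → Fin p → ℝ) :
    sampleGaussWeight y = kotzRadial 1 (1 / 2) 1 (sampleNormSq y) := by
  simp [sampleGaussWeight, kotzRadial, sampleNormSq, Finset.mul_sum]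

/-- The radial moment of order `d - 1` of the Kotz-type density. -/
noncomputable def kotzMoment (q θ s d : ℝ) : ℝ :=
  θ ^ (-((2 * q + d - 2) / (2 * s))) * (1 / (2 * s)) * Real.Gamma ((2 * q + d - 2) / (2 * s))

theorem kotzMoment_pos {q θ s d : ℝ} (hθ : 0 < θ) (hs : 0 < s) (hd : 0 < 2 * q + d - 2) :
    0 < kotzMoment q θ s d := by
  have := Real.Gamma_pos_of_pos (div_pos hd (mul_pos two_pos hs))
  unfold kotzMoment
  positivity

theorem lintegral_rpow_mul_kotzRadial {q θ s d : ℝ} (hθ : 0 < θ) (hs : 0 < s)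
    (hd : 0 < 2 * q + d - 2) :
    ∫⁻ r in Set.Ioi (0 : ℝ), ENNReal.ofReal (r ^ (d - 1)) * kotzRadial q θ s (r ^ 2) =
      ENNReal.ofReal (kotzMoment q θ s d) := by
  have h1 : ∀ r ∈ Set.Ioi (0 : ℝ), ENNReal.ofReal (r ^ (d - 1)) * kotzRadial q θ s (r ^ 2) =
      ENNReal.ofReal (r ^ (2 * q + d - 3) * Real.exp (-θ * r ^ (2 * s))) := by
    intro r hr
    have hr : 0 < r := hr
    rw [kotzRadial, ← ENNReal.ofReal_mul (by positivity), ← mul_assoc, ← Real.rpow_natCast,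
      ← Real.rpow_mul hr.le, ← Real.rpow_mul hr.le, ← Real.rpow_add hr,
      show d - 1 + ((2 : ℕ) : ℝ) * (q - 1) = 2 * q + d - 3 by push_cast; ring, Nat.cast_ofNat]
  rw [setLIntegral_congr_fun measurableSet_Ioi h1]
  have h2s : 0 < 2 * s := by positivity
  have hq : -1 < 2 * q + d - 3 := by linarith
  have hval := integral_rpow_mul_exp_neg_mul_rpow h2s hq hθ
  have hint : IntegrableOn (fun r : ℝ => r ^ (2 * q + d - 3) * Real.exp (-θ * r ^ (2 * s)))
      (Set.Ioi 0) := by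
    -- A non-integrable function has integral `0` by convention, so the positive closed form already
    -- proves integrability.
    refine MeasureTheory.Integrable.of_integral_ne_zero ?_
    rw [hval]
    have := Real.Gamma_pos_of_pos (s := (2 * q + d - 3 + 1) / (2 * s))
      (div_pos (by linarith) h2s)
    positivity
  rw [← ofReal_integral_eq_lintegral_ofReal hint, hval, kotzMoment]
  · congr 3
    · congr 1
      ring
    · congr 1
      ring
  · filter_upwards [ae_restrict_mem measurableSet_Ioi] with r hr
    have hr : 0 < r := hr
    show 0 ≤ r ^ (2 * q + d - 3) * Real.exp (-θ * r ^ (2 * s))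
    positivity

theorem finrank_sample (p n : ℕ) : Module.finrank ℝ (Fin n → Fin p → ℝ) = n * p := by
  rw [Module.finrank_pi_fintype]
  simp

/-- The order of the quantifiers is the point: `C` is chosen before `q`, `θ`, `s`, so it can be
identified from one convenient density. -/
theorem exists_lintegral_homogeneous_mul_kotzRadial {p n : ℕ} (hp : 0 < p) (hn : 0 < n)
    {F : (Fin n → Fin p → ℝ) → ℝ≥0∞} (hF : Measurable F) (k : ℝ)
    (hFhom : ∀ r : ℝ, 0 < r → ∀ y, F (r • y) = ENNReal.ofReal (r ^ k) * F y) :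
    ∃ C : ℝ≥0∞, ∀ q θ s : ℝ, 0 < θ → 0 < s → 0 < 2 * q + (n * p + k) - 2 →
      ∫⁻ y, F y * kotzRadial q θ s (sampleNormSq y) =
        C * ENNReal.ofReal (kotzMoment q θ s (n * p + k)) := by
  have : Nonempty (Fin n) := ⟨⟨0, hn⟩⟩
  have : Nonempty (Fin p) := ⟨⟨0, hp⟩⟩
  have : Nontrivial (Fin n → Fin p → ℝ) := inferInstance
  obtain ⟨C, hC⟩ := exists_lintegral_homogeneous_mul_radial
    (volume : Measure (Fin n → Fin p → ℝ)) (N := fun y => √(sampleNormSq y)) (by fun_prop)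
    (fun y hy => Real.sqrt_pos.2 (sampleNormSq_pos hy))
    (fun r hr y => by
      rw [sampleNormSq_smul, Real.sqrt_mul (sq_nonneg r), Real.sqrt_sq hr.le]) hF k hFhom
  refine ⟨C, fun q θ s hθ hs hd => ?_⟩
  have h := hC (fun r => kotzRadial q θ s (r ^ 2)) (by fun_prop)
  rw [finrank_sample] at h
  rw [← lintegral_rpow_mul_kotzRadial hθ hs hd]
  simp only [Real.sq_sqrt (sampleNormSq_nonneg _)] at h
  rw [h]
  congr 2
  funext r
  congr 3
  push_cast
  ring

/-- Multiplication by the sum of squares replaces `q` by `q + 1`, so both integrals are total masses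
with the same angular constant and their ratio is a ratio of radial moments. -/
theorem lintegral_sampleNormSq_mul_kotzRadial {p n : ℕ} (hp : 0 < p) (hn : 0 < n) {q θ s : ℝ}
    (hθ : 0 < θ) (hs : 0 < s) (hd : 0 < 2 * q + n * p - 2) :
    ∫⁻ y : Fin n → Fin p → ℝ, ENNReal.ofReal (sampleNormSq y) *
        kotzRadial q θ s (sampleNormSq y) =
      ENNReal.ofReal (θ ^ (-1 / s) * Real.Gamma ((2 * q + n * p) / (2 * s)) /
        Real.Gamma ((2 * q + n * p - 2) / (2 * s))) *
        ∫⁻ y : Fin n → Fin p → ℝ, kotzRadial q θ s (sampleNormSq y) := by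
  obtain ⟨C, hC⟩ := exists_lintegral_homogeneous_mul_kotzRadial (p := p) (n := n) hp hn
    (F := fun _ => 1) measurable_const 0 (fun r hr y => by simp)
  have h0 := hC q θ s hθ hs (by linarith)
  have h2 := hC (q + 1) θ s hθ hs (by linarith)
  simp only [one_mul] at h0 h2
  have h3 : ∀ y : Fin n → Fin p → ℝ, y ≠ 0 → ENNReal.ofReal (sampleNormSq y) *
      kotzRadial q θ s (sampleNormSq y) = kotzRadial (q + 1) θ s (sampleNormSq y) := by
    intro y hy
    have hQ := sampleNormSq_pos hy
    rw [kotzRadial, kotzRadial, ← ENNReal.ofReal_mul hQ.le, ← mul_assoc,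
      show q + 1 - 1 = 1 + (q - 1) by ring, Real.rpow_add hQ, Real.rpow_one]
  have : Nonempty (Fin n) := ⟨⟨0, hn⟩⟩
  have : Nonempty (Fin p) := ⟨⟨0, hp⟩⟩
  have : Nontrivial (Fin n → Fin p → ℝ) := inferInstance
  -- The origin is left out because `0 * 0 ^ (q - 1)` and `0 ^ q` differ when `q = 0`.
  have hae : ∀ᵐ y : Fin n → Fin p → ℝ, y ≠ 0 := by
    have : (volume : Measure (Fin n → Fin p → ℝ)) {0} = 0 := by
      simp
    exact measure_eq_zero_iff_ae_notMem.1 this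
  rw [lintegral_congr_ae (hae.mono h3), h2, h0, ← mul_assoc, mul_comm _ C, mul_assoc]
  congr 1
  have hd2 : 0 < 2 * s := by positivity
  have hΓ := (Real.Gamma_pos_of_pos (div_pos hd hd2)).ne'
  rw [← ENNReal.ofReal_mul]
  · congr 1
    rw [kotzMoment, kotzMoment, add_zero,
      show 2 * (q + 1) + (n * p : ℝ) - 2 = 2 * q + n * p by ring]
    have : θ ^ (-((2 * q + (n * p : ℝ)) / (2 * s))) =
        θ ^ (-1 / s) * θ ^ (-((2 * q + (n * p : ℝ) - 2) / (2 * s))) := by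
      rw [← Real.rpow_add hθ]
      congr 1
      field_simp
      ring
    rw [this]
    field_simp
  · have := Real.Gamma_pos_of_pos (div_pos hd hd2)
    have := Real.Gamma_pos_of_pos (s := (2 * q + n * p) / (2 * s))
      (div_pos (by linarith) hd2)
    positivity

theorem kotzC0_pos {p n : ℕ} (hp : 0 < p) (hn : p + 2 < n) {q θ s : ℝ} (hθ : 0 < θ) (hs : 0 < s)
    (hd : 0 < 2 * q + n * p - 4) : 0 < kotzC0 p n q θ s := by
  have hpR : (1 : ℝ) ≤ p := by exact_mod_cast hp
  have hnR : (p : ℝ) + 2 < n := by exact_mod_cast hn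
  have h3 : 0 < (n : ℝ) - p - 2 := by linarith
  have h4 : 0 < (n : ℝ) * p - 2 := by nlinarith
  have hd2 : 0 < 2 * s := by positivity
  have hΓ := Real.Gamma_pos_of_pos (s := (2 * q + n * p - 2) / (2 * s))
    (div_pos (by linarith) hd2)
  have hΓ' := Real.Gamma_pos_of_pos (s := (2 * q + n * p - 4) / (2 * s)) (div_pos hd hd2)
  unfold kotzC0
  positivity

/-- `C` is the angular constant of `1` and `D` that of the diagonal entry, of degree `-2`. The
Gaussian mean gives `D = (n p - 2) / (n - p - 2) * C`, and the ratio of Kotz moments of orders `n p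
- 2` and `n p` turns this into `c₀⁻¹`. -/
theorem lintegral_inv_sspMatrix_mul_kotzRadial {p n : ℕ} (hp : 0 < p) (hn : p + 2 < n) {q θ s : ℝ}
    (hθ : 0 < θ) (hs : 0 < s) (hd : 0 < 2 * q + n * p - 4) (j : Fin p) :
    ∫⁻ y : Fin n → Fin p → ℝ, ENNReal.ofReal ((sspMatrix y)⁻¹ j j) *
        kotzRadial q θ s (sampleNormSq y) =
      ENNReal.ofReal (kotzC0 p n q θ s)⁻¹ *
        ∫⁻ y : Fin n → Fin p → ℝ, kotzRadial q θ s (sampleNormSq y) := by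
  have hn0 : 0 < n := by omega
  have hpR : (1 : ℝ) ≤ p := by exact_mod_cast hp
  have hnR : (p : ℝ) + 2 < n := by exact_mod_cast hn
  have hN : 2 < (n : ℝ) * p := by nlinarith
  obtain ⟨C, hC⟩ := exists_lintegral_homogeneous_mul_kotzRadial (p := p) (n := n) hp hn0
    (F := fun _ => 1) measurable_const 0 (fun r hr y => by simp)
  obtain ⟨D, hD⟩ := exists_lintegral_homogeneous_mul_kotzRadial (p := p) (n := n) hp hn0
    (measurable_inv_sspMatrix j j).ennreal_ofReal (-2) (fun r hr y => by
      rw [inv_sspMatrix_smul hn0.ne' hr, Matrix.smul_apply, smul_eq_mul,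
        ENNReal.ofReal_mul (by positivity), Real.rpow_neg hr.le]
      norm_cast)
  have h0 := hC q θ s hθ hs (by linarith)
  have h2 := hD q θ s hθ hs (by linarith)
  have g0 := hC 1 (1 / 2) 1 (by norm_num) (by norm_num) (by linarith)
  have g2 := hD 1 (1 / 2) 1 (by norm_num) (by norm_num) (by linarith)
  simp only [one_mul, ← sampleGaussWeight_eq_kotzRadial] at h0 g0 g2
  rw [lintegral_inv_sspMatrix_mul_sampleGaussWeight hn j, g0] at g2
  rw [h2, h0]
  have pg2 := kotzMoment_pos (q := 1) (θ := 1 / 2) (s := 1) (d := n * p + -2) (by norm_num)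
    (by norm_num) (by linarith)
  have hgauss : kotzMoment 1 (1 / 2) 1 (n * p + 0) =
      (n * p - 2) * kotzMoment 1 (1 / 2) 1 (n * p + -2) := by
    have e1 : ((2 : ℝ) * 1 + (n * p + 0) - 2) / (2 * 1) = ((n : ℝ) * p - 2) / 2 + 1 := by ring
    have e2 : ((2 : ℝ) * 1 + (n * p + -2) - 2) / (2 * 1) = ((n : ℝ) * p - 2) / 2 := by ring
    rw [kotzMoment, kotzMoment, e1, e2, Real.Gamma_add_one (by
      have : 0 < ((n : ℝ) * p - 2) / 2 := by linarith
      exact this.ne'), neg_add, Real.rpow_add (by norm_num), Real.rpow_neg_one]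
    ring
  have hkotz : kotzMoment q θ s (n * p + -2) * (n * p - 2) * (1 / ((n : ℝ) - p - 2)) =
      (kotzC0 p n q θ s)⁻¹ * kotzMoment q θ s (n * p + 0) := by
    have hd2 : 0 < 2 * s := by positivity
    have hΓ := (Real.Gamma_pos_of_pos (s := (2 * q + n * p - 2) / (2 * s))
      (div_pos (by linarith) hd2)).ne'
    have hΓ' := (Real.Gamma_pos_of_pos (s := (2 * q + n * p - 4) / (2 * s))
      (div_pos hd hd2)).ne'
    have : θ ^ (-((2 * q + (n * p : ℝ) - 4) / (2 * s))) =
        θ ^ (1 / s) * θ ^ (-((2 * q + (n * p : ℝ) - 2) / (2 * s))) := by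
      rw [← Real.rpow_add hθ]
      congr 1
      field_simp
      ring
    rw [kotzMoment, kotzMoment, kotzC0, add_zero,
      show 2 * q + ((n : ℝ) * p + -2) - 2 = 2 * q + n * p - 4 by ring, this]
    have := (Real.rpow_pos_of_pos hθ (1 / s)).ne'
    have h3 : (n : ℝ) - p - 2 ≠ 0 := by linarith
    have h4 : (n : ℝ) * p - 2 ≠ 0 := by linarith
    generalize Real.Gamma ((2 * q + n * p - 2) / (2 * s)) = Γ₁ at hΓ ⊢
    generalize Real.Gamma ((2 * q + n * p - 4) / (2 * s)) = Γ₂ at hΓ' ⊢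
    field_simp
  have hc0 : 0 ≤ (kotzC0 p n q θ s)⁻¹ := (inv_pos.2 (kotzC0_pos hp hn hθ hs hd)).le
  have hDC : D = ENNReal.ofReal ((n * p - 2) * (1 / ((n : ℝ) - p - 2))) * C := by
    have h3 : 0 < (n : ℝ) - p - 2 := by linarith
    rw [hgauss, ENNReal.ofReal_mul (by linarith)] at g2
    rw [ENNReal.ofReal_mul (by linarith)]
    have hne : ENNReal.ofReal (kotzMoment 1 (1 / 2) 1 (n * p + -2)) ≠ 0 := by
      simpa using pg2
    refine ((ENNReal.mul_left_inj hne ENNReal.ofReal_ne_top).1 ?_)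
    rw [← g2]
    ring
  rw [hDC, mul_right_comm, ← ENNReal.ofReal_mul (by
    have h3 : 0 < (n : ℝ) - p - 2 := by linarith
    have h4 : 0 < (n : ℝ) * p - 2 := by linarith
    positivity), mul_comm C, ← mul_assoc, ← ENNReal.ofReal_mul hc0, ← hkotz]
  congr 2
  ring

/-! ### Symmetries of a radial law and the means of `W` and its inverse. -/

/-- Change the sign of one coordinate of one vector of a sample. -/
noncomputable def coordNeg {p n : ℕ} (a₀ : Fin n) (i₀ : Fin p) :
    (Fin n → Fin p → ℝ) ≃ₗ[ℝ] (Fin n → Fin p → ℝ) :=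
  LinearEquiv.piCongrRight fun a => LinearEquiv.piCongrRight fun i =>
    if a = a₀ ∧ i = i₀ then LinearEquiv.neg ℝ else LinearEquiv.refl ℝ ℝ

theorem coordNeg_apply {p n : ℕ} (a₀ : Fin n) (i₀ : Fin p) (y : Fin n → Fin p → ℝ) (a : Fin n)
    (i : Fin p) : coordNeg a₀ i₀ y a i = if a = a₀ ∧ i = i₀ then -y a i else y a i := by
  rw [coordNeg, LinearEquiv.piCongrRight_apply, LinearEquiv.piCongrRight_apply]
  split_ifs <;> simp

theorem sampleNormSq_coordNeg {p n : ℕ} (a₀ : Fin n) (i₀ : Fin p) (y : Fin n → Fin p → ℝ) :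
    sampleNormSq (coordNeg a₀ i₀ y) = sampleNormSq y := by
  refine Finset.sum_congr rfl fun a _ => Finset.sum_congr rfl fun i _ => ?_
  rw [coordNeg_apply]
  split_ifs <;> ring

/-- Permute all coordinates of a sample. -/
def coordPerm {p n : ℕ} (σ : Equiv.Perm (Fin n × Fin p)) :
    (Fin n → Fin p → ℝ) ≃ₗ[ℝ] (Fin n → Fin p → ℝ) :=
  (LinearEquiv.curry ℝ ℝ (Fin n) (Fin p)).symm ≪≫ₗ LinearEquiv.funCongrLeft ℝ ℝ σ ≪≫ₗ
    LinearEquiv.curry ℝ ℝ (Fin n) (Fin p)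

theorem coordPerm_apply {p n : ℕ} (σ : Equiv.Perm (Fin n × Fin p)) (y : Fin n → Fin p → ℝ)
    (a : Fin n) (i : Fin p) : coordPerm σ y a i = y (σ (a, i)).1 (σ (a, i)).2 := rfl

theorem sampleNormSq_coordPerm {p n : ℕ} (σ : Equiv.Perm (Fin n × Fin p))
    (y : Fin n → Fin p → ℝ) : sampleNormSq (coordPerm σ y) = sampleNormSq y := by
  simp only [sampleNormSq, coordPerm_apply]
  rw [← Fintype.sum_prod_type' (f := fun a i => y a i ^ 2),
    ← Fintype.sum_prod_type' (f := fun a i => y (σ (a, i)).1 (σ (a, i)).2 ^ 2)]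
  exact Equiv.sum_comp σ fun x => y x.1 x.2 ^ 2

/-- Apply an invertible matrix to all vectors of a sample. -/
def sampleMulVec {p : ℕ} (n : ℕ) {T T' : Matrix (Fin p) (Fin p) ℝ} (h : T * T' = 1)
    (h' : T' * T = 1) : (Fin n → Fin p → ℝ) ≃ₗ[ℝ] (Fin n → Fin p → ℝ) :=
  LinearEquiv.piCongrRight fun _ => Matrix.toLin'OfInv h' h

theorem sampleMulVec_apply {p n : ℕ} {T T' : Matrix (Fin p) (Fin p) ℝ} (h : T * T' = 1)
    (h' : T' * T = 1) (y : Fin n → Fin p → ℝ) :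
    sampleMulVec n h h' y = fun a => T.mulVec (y a) := rfl

section

variable {p n : ℕ} {g : ℝ → ℝ≥0∞} {μ : Measure (Fin n → Fin p → ℝ)}

theorem measurePreserving_of_sampleNormSq_comp [IsFiniteMeasure μ] (hg : Measurable g)
    (hμ : μ = volume.withDensity fun y => g (sampleNormSq y))
    (L : (Fin n → Fin p → ℝ) ≃ₗ[ℝ] (Fin n → Fin p → ℝ))
    (hL : ∀ y, sampleNormSq (L y) = sampleNormSq y) : MeasurePreserving L μ μ := by
  subst hμ
  exact measurePreserving_withDensity_of_comp_eq volume (by fun_prop) L fun y => by rw [hL]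

theorem integral_eq_zero_of_comp_eq_neg {X : Type*} [MeasurableSpace X] {μ : Measure X}
    {L : X → X} (hL : MeasurePreserving L μ μ) {f : X → ℝ} (hf : AEStronglyMeasurable f μ)
    (h : ∀ x, f (L x) = -f x) : ∫ x, f x ∂μ = 0 := by
  have h1 : ∫ x, f x ∂μ = ∫ x, f (L x) ∂μ := by
    conv_lhs => rw [← hL.map_eq]
    rw [integral_map hL.measurable.aemeasurable (by rwa [hL.map_eq])]
  simp only [h, integral_neg] at h1
  linarith

theorem integrable_and_integral_eq_of_lintegral_ofReal {X : Type*} [MeasurableSpace X]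
    {μ : Measure X} {f : X → ℝ} (hf : AEStronglyMeasurable f μ) (h0 : 0 ≤ᵐ[μ] f) {κ : ℝ}
    (hκ : 0 ≤ κ) (h : ∫⁻ x, ENNReal.ofReal (f x) ∂μ = ENNReal.ofReal κ) :
    Integrable f μ ∧ ∫ x, f x ∂μ = κ := by
  refine ⟨⟨hf, ?_⟩, ?_⟩
  · rw [hasFiniteIntegral_iff_ofReal h0, h]
    exact ENNReal.ofReal_lt_top
  · rw [integral_eq_lintegral_of_nonneg_ae h0 hf, h, ENNReal.toReal_ofReal hκ]

theorem integrable_mul_coord (hQ : Integrable sampleNormSq μ) (a b : Fin n) (i j : Fin p) :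
    Integrable (fun y => y a i * y b j) μ := by
  refine hQ.mono (by fun_prop) (ae_of_all _ fun y => ?_)
  rw [Real.norm_eq_abs, Real.norm_eq_abs, abs_of_nonneg (sampleNormSq_nonneg y), abs_le]
  have h1 := sq_le_sampleNormSq y a i
  have h2 := sq_le_sampleNormSq y b j
  constructor <;> nlinarith [sq_nonneg (y a i + y b j), sq_nonneg (y a i - y b j)]

/-- Coordinate transpositions make all `n p` second moments equal, and they add up to `κ`; changing
the sign of one coordinate kills every mixed product. -/
theorem integral_mul_coord [IsFiniteMeasure μ] (hg : Measurable g)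
    (hμ : μ = volume.withDensity fun y => g (sampleNormSq y)) (hQ : Integrable sampleNormSq μ)
    {κ : ℝ} (hκ : ∫ y, sampleNormSq y ∂μ = κ) (a b : Fin n) (i j : Fin p) :
    ∫ y, y a i * y b j ∂μ = if a = b ∧ i = j then κ / (n * p) else 0 := by
  split_ifs with h
  · obtain ⟨rfl, rfl⟩ := h
    have h1 : ∀ (b : Fin n) (j : Fin p), ∫ y, y b j ^ 2 ∂μ = ∫ y, y a i ^ 2 ∂μ := by
      intro b j
      have hmp := measurePreserving_of_sampleNormSq_comp hg hμ
        (coordPerm (Equiv.swap (a, i) (b, j))) (sampleNormSq_coordPerm _)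
      conv_rhs => rw [← hmp.map_eq]
      rw [integral_map hmp.measurable.aemeasurable (Measurable.aestronglyMeasurable (by fun_prop))]
      simp only [coordPerm_apply, Equiv.swap_apply_left]
    have h2 : ∀ (b : Fin n) (j : Fin p), Integrable (fun y => y b j ^ 2) μ := by
      intro b j
      simpa only [sq] using integrable_mul_coord hQ b b j j
    have h3 : κ = n * p * ∫ y, y a i ^ 2 ∂μ := by
      rw [← hκ]
      simp only [sampleNormSq]
      rw [integral_finsetSum _ fun b _ => integrable_finsetSum _ fun j _ => h2 b j]
      simp only [integral_finsetSum _ fun j _ => h2 _ j, h1]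
      simp [mul_assoc]
    have hn : (n : ℝ) ≠ 0 := Nat.cast_ne_zero.2 (Fin.pos a).ne'
    have hp : (p : ℝ) ≠ 0 := Nat.cast_ne_zero.2 (Fin.pos i).ne'
    simp only [← sq]
    rw [h3]
    field_simp
  · refine integral_eq_zero_of_comp_eq_neg (measurePreserving_of_sampleNormSq_comp hg hμ
      (coordNeg a i) (sampleNormSq_coordNeg a i)) (by fun_prop) fun y => ?_
    have h' : ¬(b = a ∧ j = i) := fun ⟨h1, h2⟩ => h ⟨h1.symm, h2.symm⟩
    rw [coordNeg_apply, coordNeg_apply, if_pos ⟨rfl, rfl⟩, if_neg h', neg_mul]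

theorem sspMatrix_apply (hn : n ≠ 0) (y : Fin n → Fin p → ℝ) (i j : Fin p) :
    sspMatrix y i j = ∑ a, y a i * y a j - (n : ℝ)⁻¹ * ∑ a, ∑ b, y a i * y b j := by
  have hn' : (n : ℝ) ≠ 0 := Nat.cast_ne_zero.2 hn
  have hm : ∀ k, sampleMean y k = (n : ℝ)⁻¹ * ∑ a, y a k := by
    intro k
    simp [sampleMean]
  simp only [sspMatrix, Matrix.sum_apply, Matrix.vecMulVec_apply, Pi.sub_apply, hm, sub_mul,
    mul_sub, Finset.sum_sub_distrib, ← Finset.sum_mul, ← Finset.mul_sum, Finset.sum_const,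
    Finset.card_univ, Fintype.card_fin, nsmul_eq_mul]
  field_simp
  ring

theorem integral_sspMatrix [IsFiniteMeasure μ] (hg : Measurable g)
    (hμ : μ = volume.withDensity fun y => g (sampleNormSq y)) (hQ : Integrable sampleNormSq μ)
    {κ : ℝ} (hκ : ∫ y, sampleNormSq y ∂μ = κ) (hn : n ≠ 0) (i j : Fin p) :
    Integrable (fun y => sspMatrix y i j) μ ∧
      ∫ y, sspMatrix y i j ∂μ = (n - 1) * (κ / (n * p)) * (1 : Matrix (Fin p) (Fin p) ℝ) i j := by
  simp only [sspMatrix_apply hn]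
  have h1 : Integrable (fun y : Fin n → Fin p → ℝ => ∑ a, y a i * y a j) μ :=
    integrable_finsetSum _ fun a _ => integrable_mul_coord hQ a a i j
  have h2 : Integrable (fun y : Fin n → Fin p → ℝ =>
      (n : ℝ)⁻¹ * ∑ a, ∑ b, y a i * y b j) μ :=
    (integrable_finsetSum _ fun a _ => integrable_finsetSum _ fun b _ =>
      integrable_mul_coord hQ a b i j).const_mul _
  refine ⟨h1.sub h2, ?_⟩
  rw [integral_sub h1 h2, integral_const_mul,
    integral_finsetSum _ fun a _ => integrable_mul_coord hQ a a i j,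
    integral_finsetSum _ fun a _ => integrable_finsetSum _ fun b _ => integrable_mul_coord hQ a b i j]
  simp only [integral_finsetSum _ fun b _ => integrable_mul_coord hQ _ b i j,
    integral_mul_coord hg hμ hQ hκ]
  have hn' : (n : ℝ) ≠ 0 := Nat.cast_ne_zero.2 hn
  by_cases hij : i = j
  · subst hij
    simp
    field_simp
  · simp [hij]

/-- The vanishing of the means of the off-diagonal entries comes from the invariance under
a change of the sign of one column. -/
theorem integral_inv_sspMatrix [IsFiniteMeasure μ] (hn : n ≠ 0) (hg : Measurable g)
    (hμ : μ = volume.withDensity fun y => g (sampleNormSq y)) {κ : ℝ} (hκ : 0 ≤ κ)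
    (h : ∀ j, ∫⁻ y, ENNReal.ofReal ((sspMatrix y)⁻¹ j j) ∂μ = ENNReal.ofReal κ) (i j : Fin p) :
    Integrable (fun y => (sspMatrix y)⁻¹ i j) μ ∧
      ∫ y, (sspMatrix y)⁻¹ i j ∂μ = κ * (1 : Matrix (Fin p) (Fin p) ℝ) i j := by
  have hpos : ∀ y : Fin n → Fin p → ℝ, (sspMatrix y)⁻¹.PosSemidef := fun y => by
    rw [sspMatrix_eq_gram]
    exact (Matrix.posSemidef_gram ℝ _).inv
  have hd : ∀ k, Integrable (fun y => (sspMatrix y)⁻¹ k k) μ ∧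
      ∫ y, (sspMatrix y)⁻¹ k k ∂μ = κ := fun k =>
    integrable_and_integral_eq_of_lintegral_ofReal
      (measurable_inv_sspMatrix k k).aestronglyMeasurable
      (ae_of_all _ fun y => (hpos y).diag_nonneg) hκ (h k)
  by_cases hij : i = j
  · subst hij
    rw [Matrix.one_apply_eq, mul_one]
    exact hd i
  refine ⟨?_, ?_⟩
  · refine ((hd i).1.add (hd j).1).mono (measurable_inv_sspMatrix i j).aestronglyMeasurable
      (ae_of_all _ fun y => ?_)
    -- Semidefiniteness tested on `e_i + c e_j`; `c = 1` and `c = -1` bound the off-diagonal entry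
    -- by the sum of two diagonal ones, whose integrability is known.
    have hq : ∀ c : ℝ, 0 ≤ (sspMatrix y)⁻¹ i i + c * (2 * (sspMatrix y)⁻¹ i j) +
        c ^ 2 * (sspMatrix y)⁻¹ j j := by
      intro c
      have h1 := (hpos y).dotProduct_mulVec_nonneg (Pi.single i 1 + c • Pi.single j 1)
      have hsymm : (sspMatrix y)⁻¹ j i = (sspMatrix y)⁻¹ i j := by
        simpa using (hpos y).isHermitian.apply i j
      have hstar : star (Pi.single i 1 + c • Pi.single j 1 : Fin p → ℝ) =
          Pi.single i 1 + c • Pi.single j 1 := by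
        ext k
        simp
      rw [hstar, Matrix.mulVec_add, Matrix.mulVec_smul, Matrix.mulVec_single_one,
        Matrix.mulVec_single_one, add_dotProduct, smul_dotProduct, single_one_dotProduct,
        single_one_dotProduct] at h1
      simp only [Pi.add_apply, Pi.smul_apply, Matrix.col_apply, smul_eq_mul, hsymm] at h1
      linarith
    have h1 := hq 1
    have h2 := hq (-1)
    have h3 := (hpos y).diag_nonneg (i := i)
    have h4 := (hpos y).diag_nonneg (i := j)
    rw [Real.norm_eq_abs, Real.norm_eq_abs, Pi.add_apply, abs_of_nonneg (add_nonneg h3 h4), abs_le]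
    constructor <;> linarith
  · rw [Matrix.one_apply_ne hij, mul_zero]
    set D : Matrix (Fin p) (Fin p) ℝ := Matrix.diagonal fun k => if k = i then -1 else 1 with hD
    have hDD : D * D = 1 := by
      rw [hD, Matrix.diagonal_mul_diagonal, ← Matrix.diagonal_one]
      congr 1
      funext k
      split_ifs <;> norm_num
    refine integral_eq_zero_of_comp_eq_neg (measurePreserving_of_sampleNormSq_comp hg hμ
      (sampleMulVec n hDD hDD) fun y => ?_) (measurable_inv_sspMatrix i j).aestronglyMeasurable
      fun y => ?_
    · refine Finset.sum_congr rfl fun a _ => Finset.sum_congr rfl fun k _ => ?_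
      simp only [sampleMulVec_apply, hD, Matrix.mulVec_diagonal]
      split_ifs <;> ring
    · have h1 := sspMatrix_add_mulVec hn 0 D y
      simp only [zero_add] at h1
      have hDinv : D⁻¹ = D := Matrix.inv_eq_right_inv hDD
      have hDt : D.transpose = D := Matrix.diagonal_transpose _
      rw [sampleMulVec_apply, h1, hDt, Matrix.mul_inv_rev, Matrix.mul_inv_rev, hDinv, hD,
        Matrix.diagonal_mul, Matrix.mul_diagonal, if_pos rfl, if_neg (Ne.symm hij)]
      ring

end

/-! ### Reduction of the Kotz-type model to a radial law. -/

open scoped MatrixOrder in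
theorem exists_mul_transpose_eq_of_posDef {p : ℕ} {S : Matrix (Fin p) (Fin p) ℝ} (hS : S.PosDef) :
    ∃ T T' : Matrix (Fin p) (Fin p) ℝ, T * T' = 1 ∧ T' * T = 1 ∧ T * T.transpose = S := by
  obtain ⟨B, hB⟩ := CStarAlgebra.nonneg_iff_eq_star_mul_self.mp hS.posSemidef.nonneg
  rw [Matrix.star_eq_conjTranspose, Matrix.conjTranspose_eq_transpose_of_trivial] at hB
  have hdet : IsUnit B.transpose.det := by
    have h1 := hS.det_pos.ne'
    rw [hB, Matrix.det_mul] at h1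
    exact (left_ne_zero_of_mul h1).isUnit
  exact ⟨B.transpose, B.transpose⁻¹, Matrix.mul_nonsing_inv _ hdet, Matrix.nonsing_inv_mul _ hdet,
    by rw [Matrix.transpose_transpose, ← hB]⟩

theorem dotProduct_inv_mulVec_mulVec {p : ℕ} {S T T' : Matrix (Fin p) (Fin p) ℝ} (h : T * T' = 1)
    (h' : T' * T = 1) (hS : T * T.transpose = S) (v : Fin p → ℝ) :
    T.mulVec v ⬝ᵥ S⁻¹.mulVec (T.mulVec v) = ∑ i, v i ^ 2 := by
  have hinv : S⁻¹ = T'.transpose * T' := by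
    refine Matrix.inv_eq_right_inv ?_
    rw [← hS, Matrix.mul_assoc, ← Matrix.mul_assoc T.transpose, ← Matrix.transpose_mul, h',
      Matrix.transpose_one, Matrix.one_mul, h]
  rw [hinv, Matrix.mulVec_mulVec, Matrix.mul_assoc, h', Matrix.mul_one, Matrix.dotProduct_mulVec,
    Matrix.vecMul_transpose, Matrix.mulVec_mulVec, h', Matrix.one_mulVec]
  simp [dotProduct, sq]

theorem measurable_kotzDensity {p n : ℕ} (q θ s : ℝ) (m : Fin p → ℝ)
    (S : Matrix (Fin p) (Fin p) ℝ) :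
    Measurable (kotzDensity q θ s m S : (Fin n → Fin p → ℝ) → ℝ) := by
  unfold kotzDensity kotzGenerator
  simp only [Matrix.mulVec, dotProduct, Pi.sub_apply]
  fun_prop

theorem ofReal_kotzDensity_add_mulVec {p n : ℕ} (hp : 0 < p) (hn : 0 < n) {q θ s : ℝ} (hθ : 0 < θ)
    (hs : 0 < s) (hd : 0 < 2 * q + p * n - 2) (m : Fin p → ℝ) {S T T' : Matrix (Fin p) (Fin p) ℝ}
    (hSpos : S.PosDef) (h : T * T' = 1) (h' : T' * T = 1) (hS : T * T.transpose = S) :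
    ∃ K : ℝ≥0∞, ∀ y : Fin n → Fin p → ℝ,
      ENNReal.ofReal (kotzDensity q θ s m S fun a => m + T.mulVec (y a)) =
        K * kotzRadial q θ s (sampleNormSq y) := by
  refine ⟨ENNReal.ofReal (S.det ^ (-(n : ℝ) / 2) *
    (s * θ ^ ((2 * q + p * n - 2) / (2 * s)) * Real.Gamma (p * n / 2) /
      (Real.pi ^ ((p * n : ℝ) / 2) * Real.Gamma ((2 * q + p * n - 2) / (2 * s))))), fun y => ?_⟩
  have hp' : (0 : ℝ) < p := by exact_mod_cast hp
  have hn' : (0 : ℝ) < n := by exact_mod_cast hn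
  have h1 := hSpos.det_pos
  have h2 := Real.Gamma_pos_of_pos (s := (p : ℝ) * n / 2) (by positivity)
  have h3 := Real.Gamma_pos_of_pos (s := (2 * q + p * n - 2) / (2 * s))
    (div_pos hd (by positivity))
  rw [kotzRadial, ← ENNReal.ofReal_mul (by positivity), kotzDensity, kotzGenerator]
  simp only [add_sub_cancel_left, dotProduct_inv_mulVec_mulVec h h' hS]
  rw [sampleNormSq]
  congr 1
  ring

/-- The Kotz-type model is the image of a radial model by an affine map. -/
theorem kotzModel_eq_map {p n : ℕ} (hp : 0 < p) (hn : 0 < n) {q θ s : ℝ} (hθ : 0 < θ)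
    (hs : 0 < s) (hd : 0 < 2 * q + p * n - 2) (m : Fin p → ℝ) {S T T' : Matrix (Fin p) (Fin p) ℝ}
    (hSpos : S.PosDef) (h : T * T' = 1) (h' : T' * T = 1) (hS : T * T.transpose = S) :
    ∃ c : ℝ≥0∞, kotzModel p n q θ s m S =
      ((volume : Measure (Fin n → Fin p → ℝ)).withDensity
        fun y => c * kotzRadial q θ s (sampleNormSq y)).map fun y a => m + T.mulVec (y a) := by
  obtain ⟨K, hK⟩ := ofReal_kotzDensity_add_mulVec hp hn hθ hs hd m hSpos h h' hS
  set L := sampleMulVec n h h' with hL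
  have hLm : Measurable L := L.toLinearMap.continuous_of_finiteDimensional.measurable
  have hdet : LinearMap.det (L : (Fin n → Fin p → ℝ) →ₗ[ℝ] (Fin n → Fin p → ℝ)) ≠ 0 :=
    L.isUnit_det'.ne_zero
  set φ : (Fin n → Fin p → ℝ) → (Fin n → Fin p → ℝ) := fun y a => m + T.mulVec (y a) with hφ
  have hφL : φ = (fun y => (fun _ => m) + y) ∘ L := rfl
  have hφm : Measurable φ := by
    rw [hφL]
    exact (measurable_const_add _).comp hLm
  set f : (Fin n → Fin p → ℝ) → ℝ≥0∞ := fun x => ENNReal.ofReal (kotzDensity q θ s m S x) with hf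
  have hfm : Measurable f := (measurable_kotzDensity q θ s m S).ennreal_ofReal
  -- `c` is the Jacobian factor; only its being nonzero and finite matters, since the normalization
  -- is recovered later from total mass one.
  obtain ⟨c, hc0, hctop, hc⟩ : ∃ c : ℝ≥0∞, c ≠ 0 ∧ c ≠ ∞ ∧
      (volume : Measure (Fin n → Fin p → ℝ)).map φ = c • volume := by
    refine ⟨ENNReal.ofReal
      |(LinearMap.det (L : (Fin n → Fin p → ℝ) →ₗ[ℝ] (Fin n → Fin p → ℝ)))⁻¹|, ?_,
      ENNReal.ofReal_ne_top, ?_⟩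
    · rw [ne_eq, ENNReal.ofReal_eq_zero, not_le]
      exact abs_pos.2 (inv_ne_zero hdet)
    · rw [hφL, ← Measure.map_map (measurable_const_add _) hLm]
      have := Measure.map_linearMap_addHaar_eq_smul_addHaar
        (volume : Measure (Fin n → Fin p → ℝ)) hdet
      rw [LinearEquiv.coe_coe] at this
      rw [this, Measure.map_smul, map_add_left_eq_self]
  refine ⟨c⁻¹ * K, ?_⟩
  have h1 := map_withDensity_comp (volume : Measure (Fin n → Fin p → ℝ)) hφm hfm
  rw [hc, withDensity_smul_measure] at h1
  have h2 : ∀ y, c⁻¹ * K * kotzRadial q θ s (sampleNormSq y) = c⁻¹ * f (φ y) := fun y => by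
    rw [mul_assoc, ← hK]
  simp only [h2]
  have h3 : (volume : Measure (Fin n → Fin p → ℝ)).withDensity (fun y => c⁻¹ * f (φ y)) =
      c⁻¹ • volume.withDensity fun y => f (φ y) :=
    withDensity_smul c⁻¹ (hfm.comp hφm)
  rw [h3, Measure.map_smul, h1, smul_smul, ENNReal.inv_mul_cancel hc0 hctop, one_smul]
  rfl

/-! ### Measurability on matrices, and the risk of multiples of the inverse. -/

instance matrixBorelSpace (p : ℕ) : BorelSpace (Matrix (Fin p) (Fin p) ℝ) :=
  inferInstanceAs (BorelSpace (Fin p → Fin p → ℝ))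

theorem measurable_matrix_apply {p : ℕ} (i j : Fin p) :
    Measurable fun B : Matrix (Fin p) (Fin p) ℝ => B i j :=
  (continuous_id.matrix_elem i j).measurable

theorem measurable_matrix_inv_apply {p : ℕ} (i j : Fin p) :
    Measurable fun B : Matrix (Fin p) (Fin p) ℝ => B⁻¹ i j := by
  simp only [Matrix.inv_def, Matrix.smul_apply, smul_eq_mul, Ring.inverse_eq_inv']
  exact (continuous_id.matrix_det).measurable.inv.mul
    (continuous_id.matrix_adjugate.matrix_elem i j).measurable

/-- Semidefiniteness is a closed condition and `det ≠ 0` an open one. Measurability is needed to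
move the almost sure statement between `A` and the sample. -/
theorem measurableSet_posDef (p : ℕ) :
    MeasurableSet {B : Matrix (Fin p) (Fin p) ℝ | B.PosDef} := by
  have h : {B : Matrix (Fin p) (Fin p) ℝ | B.PosDef} =
      ({B | B.transpose = B} ∩ ⋂ v : Fin p → ℝ, {B | 0 ≤ v ⬝ᵥ B.mulVec v}) ∩ {B | B.det ≠ 0} := by
    ext B
    have hp : B.PosSemidef ↔ B.transpose = B ∧ ∀ v : Fin p → ℝ, 0 ≤ v ⬝ᵥ B.mulVec v := by
      rw [Matrix.posSemidef_iff_dotProduct_mulVec, Matrix.IsHermitian,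
        Matrix.conjTranspose_eq_transpose_of_trivial]
      simp
    constructor
    · intro hB
      have hB : B.PosDef := hB
      have h1 := hp.1 hB.posSemidef
      exact ⟨⟨h1.1, Set.mem_iInter.2 fun v => h1.2 v⟩, hB.det_pos.ne'⟩
    · rintro ⟨⟨h1, h2⟩, h3⟩
      exact (hp.2 ⟨h1, fun v => Set.mem_iInter.1 h2 v⟩).posDef_iff_det_ne_zero.2 h3
  rw [h]
  refine ((isClosed_eq (by fun_prop) (by fun_prop)).inter
    (isClosed_iInter fun v => isClosed_le (by fun_prop) (by fun_prop))).measurableSet.inter ?_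
  exact (isOpen_ne_fun (continuous_id.matrix_det) continuous_const).measurableSet

theorem integral_mul_mul_apply {X : Type*} [MeasurableSpace X] {μ : Measure X} {p : ℕ}
    {M : X → Matrix (Fin p) (Fin p) ℝ} {κ : ℝ}
    (h : ∀ i j, Integrable (fun x => M x i j) μ ∧
      ∫ x, M x i j ∂μ = κ * (1 : Matrix (Fin p) (Fin p) ℝ) i j)
    (U V : Matrix (Fin p) (Fin p) ℝ) (i j : Fin p) :
    Integrable (fun x => (U * M x * V) i j) μ ∧ ∫ x, (U * M x * V) i j ∂μ = κ * (U * V) i j := by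
  have h1 : ∀ x, (U * M x * V) i j = ∑ l, ∑ k, U i k * M x k l * V l j := by
    intro x
    simp only [Matrix.mul_apply, Finset.sum_mul]
  have h2 : ∀ l k, Integrable (fun x => U i k * M x k l * V l j) μ := fun l k =>
    ((h k l).1.const_mul _).mul_const _
  simp only [h1]
  refine ⟨integrable_finsetSum _ fun l _ => integrable_finsetSum _ fun k _ => h2 l k, ?_⟩
  rw [integral_finsetSum _ fun l _ => integrable_finsetSum _ fun k _ => h2 l k]
  simp only [integral_finsetSum _ fun k _ => h2 _ k, integral_mul_const, integral_const_mul, (h _ _).2]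
  rw [Matrix.mul_apply, Finset.mul_sum]
  refine Finset.sum_congr rfl fun l _ => ?_
  rw [Finset.sum_eq_single l]
  · rw [Matrix.one_apply_eq]
    ring
  · intro k _ hk
    rw [Matrix.one_apply_ne hk]
    ring
  · simp

/-- Both cross terms have trace `tr S⁻¹`, one of them by cyclicity, so the loss is affine in the
entries of `B` and `B⁻¹` and only their means enter the risk. -/
theorem efronMorrisLoss_smul_inv {p : ℕ} (ν : ℝ) (S : Matrix (Fin p) (Fin p) ℝ)
    {B : Matrix (Fin p) (Fin p) ℝ} (hB : IsUnit B.det) (α : ℝ) :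
    efronMorrisLoss ν S (α • B⁻¹) B =
      (α ^ 2 * ∑ i, B⁻¹ i i - 2 * α * (S⁻¹).trace + ∑ i, (S⁻¹ * S⁻¹ * B) i i) /
        (ν * (S⁻¹).trace) := by
  have h1 : (α • B⁻¹ - S⁻¹) ^ 2 * B =
      α ^ 2 • B⁻¹ - α • (B⁻¹ * S⁻¹ * B) - α • S⁻¹ + S⁻¹ * S⁻¹ * B := by
    rw [sq, sub_mul, mul_sub, mul_sub, sub_mul, sub_mul, sub_mul]
    simp only [Matrix.smul_mul, Matrix.mul_smul, smul_smul, Matrix.mul_assoc,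
      Matrix.nonsing_inv_mul _ hB, Matrix.mul_one, sq]
    abel
  have h2 : (B⁻¹ * S⁻¹ * B).trace = (S⁻¹).trace := by
    rw [Matrix.trace_mul_comm, ← Matrix.mul_assoc, Matrix.mul_nonsing_inv _ hB, Matrix.one_mul]
  have h3 : ∑ i, (S⁻¹ * S⁻¹ * B) i i = (S⁻¹ * S⁻¹ * B).trace := rfl
  have h4 : ∑ i, B⁻¹ i i = (B⁻¹).trace := rfl
  rw [efronMorrisLoss, h1, Matrix.trace_add, Matrix.trace_sub, Matrix.trace_sub, Matrix.trace_smul,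
    Matrix.trace_smul, Matrix.trace_smul, h2, h3, h4]
  simp only [smul_eq_mul]
  congr 1
  ring

/-- The risk of a multiple of the inverse, from the means of the matrix and of its inverse. -/
theorem efronMorrisRisk_smul_inv {Ω : Type*} [MeasurableSpace Ω] {P : Measure Ω}
    [IsProbabilityMeasure P] {p : ℕ} (hp : 0 < p) {S : Matrix (Fin p) (Fin p) ℝ} (hS : S.PosDef)
    {A : Ω → Matrix (Fin p) (Fin p) ℝ} (hA : ∀ᵐ ω ∂P, (A ω).PosDef) {c₀ c₁ ν : ℝ}
    (h1 : ∀ i j, Integrable (fun ω => A ω i j) P ∧ ∫ ω, A ω i j ∂P = c₁ * S i j)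
    (h0 : ∀ i j, Integrable (fun ω => (A ω)⁻¹ i j) P ∧ ∫ ω, (A ω)⁻¹ i j ∂P = c₀⁻¹ * S⁻¹ i j)
    (α : ℝ) :
    Integrable (fun ω => efronMorrisLoss ν S (α • (A ω)⁻¹) (A ω)) P ∧
      efronMorrisRisk P A ν S (fun B => α • B⁻¹) = (α ^ 2 * c₀⁻¹ - 2 * α + c₁) / ν := by
  have hae : ∀ᵐ ω ∂P, (α ^ 2 * ∑ i, (A ω)⁻¹ i i - 2 * α * (S⁻¹).trace +
      ∑ i, (S⁻¹ * S⁻¹ * A ω) i i) / (ν * (S⁻¹).trace) =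
      efronMorrisLoss ν S (α • (A ω)⁻¹) (A ω) := by
    filter_upwards [hA] with ω hω
    rw [efronMorrisLoss_smul_inv _ _ hω.det_pos.ne'.isUnit]
  have i1 : Integrable (fun ω => α ^ 2 * ∑ i, (A ω)⁻¹ i i) P :=
    (integrable_finsetSum _ fun i _ => (h0 i i).1).const_mul _
  have hmul : ∀ (ω : Ω) (i : Fin p), (S⁻¹ * S⁻¹ * A ω) i i =
      ∑ k, (S⁻¹ * S⁻¹) i k * A ω k i := fun ω i => Matrix.mul_apply
  have i2 : ∀ i, Integrable (fun ω => (S⁻¹ * S⁻¹ * A ω) i i) P := fun i => by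
    simp only [hmul]
    exact integrable_finsetSum _ fun k _ => (h1 k i).1.const_mul _
  have i3 : Integrable (fun ω => ∑ i, (S⁻¹ * S⁻¹ * A ω) i i) P :=
    integrable_finsetSum _ fun i _ => i2 i
  have i4 : Integrable (fun ω => α ^ 2 * ∑ i, (A ω)⁻¹ i i - 2 * α * (S⁻¹).trace) P :=
    i1.sub (integrable_const _)
  refine ⟨((i4.add i3).div_const _).congr hae, ?_⟩
  have : Nonempty (Fin p) := ⟨⟨0, hp⟩⟩
  have ht : (S⁻¹).trace ≠ 0 := hS.inv.trace_pos.ne'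
  have e1 : ∫ ω, ∑ i, (A ω)⁻¹ i i ∂P = c₀⁻¹ * (S⁻¹).trace := by
    rw [integral_finsetSum _ fun i _ => (h0 i i).1]
    simp only [(h0 _ _).2, ← Finset.mul_sum]
    rfl
  have e2 : ∫ ω, ∑ i, (S⁻¹ * S⁻¹ * A ω) i i ∂P = c₁ * (S⁻¹).trace := by
    rw [integral_finsetSum _ fun i _ => i2 i]
    have e3 : ∀ i, ∫ ω, (S⁻¹ * S⁻¹ * A ω) i i ∂P = c₁ * S⁻¹ i i := by
      intro i
      simp only [hmul]
      rw [integral_finsetSum _ fun k _ => (h1 k i).1.const_mul _]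
      simp only [integral_const_mul, (h1 _ _).2]
      have e4 : S⁻¹ * S⁻¹ * S = S⁻¹ := by
        rw [Matrix.mul_assoc, Matrix.nonsing_inv_mul _ hS.det_pos.ne'.isUnit, Matrix.mul_one]
      conv_rhs => rw [← e4]
      rw [Matrix.mul_apply, Finset.mul_sum]
      exact Finset.sum_congr rfl fun k _ => by ring
    simp only [e3, ← Finset.mul_sum]
    rfl
  rw [efronMorrisRisk, ← integral_congr_ae hae, integral_div, integral_add i4 i3,
    integral_sub i1 (integrable_const _), integral_const_mul, e1, e2, integral_const,
    probReal_univ, one_smul]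
  by_cases hν : ν = 0
  · simp [hν]
  field_simp

/-! ### Assembly. -/

/-- Existence of a standardized sample: the Kotz-Wishart law is the law of `T W Tᵀ`, where `T Tᵀ` is
the scale matrix, and the means of `W` and of its inverse are multiples of the identity. -/
theorem exists_kotzWishart_eq_map {p n : ℕ} (hp : 0 < p) (hn : p + 2 < n) {q θ s : ℝ} (hθ : 0 < θ)
    (hs : 0 < s) (hq : 2 < 2 * q + p) (m : Fin p → ℝ) {S : Matrix (Fin p) (Fin p) ℝ}
    (hS : S.PosDef) (hprob : IsProbabilityMeasure (kotzWishart p n q θ s m S)) :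
    ∃ (T T' : Matrix (Fin p) (Fin p) ℝ) (μ : Measure (Fin n → Fin p → ℝ)),
      T * T' = 1 ∧ T * T.transpose = S ∧ kotzWishart p n q θ s m S =
        μ.map (fun y => T * sspMatrix y * T.transpose) ∧
      (∀ᵐ y ∂μ, (sspMatrix y).PosDef) ∧
      (∀ i j, Integrable (fun y => sspMatrix y i j) μ ∧
        ∫ y, sspMatrix y i j ∂μ = kotzC1 p n q θ s * (1 : Matrix (Fin p) (Fin p) ℝ) i j) ∧
      (∀ i j, Integrable (fun y => (sspMatrix y)⁻¹ i j) μ ∧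
        ∫ y, (sspMatrix y)⁻¹ i j ∂μ =
          (kotzC0 p n q θ s)⁻¹ * (1 : Matrix (Fin p) (Fin p) ℝ) i j) := by
  have hn0 : 0 < n := by omega
  have hpR : (1 : ℝ) ≤ p := by exact_mod_cast hp
  have hnR : (p : ℝ) + 3 ≤ n := by exact_mod_cast hn
  -- Positivity of the Gamma argument for the moment of degree `-2`: `2 q + n p - 4 > (n - 1) p - 2
  -- > 0`, from `2 q + p > 2` and `n ≥ p + 3`.
  have hd : 0 < 2 * q + (n : ℝ) * p - 4 := by nlinarith
  obtain ⟨T, T', h, h', hT⟩ := exists_mul_transpose_eq_of_posDef hS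
  obtain ⟨c, hc⟩ := kotzModel_eq_map hp hn0 hθ hs (by linarith) m hS h h' hT
  set w : (Fin n → Fin p → ℝ) → ℝ≥0∞ := fun y => kotzRadial q θ s (sampleNormSq y) with hw
  have hwm : Measurable w := by fun_prop
  set μ : Measure (Fin n → Fin p → ℝ) := volume.withDensity fun y => c * w y with hμ
  have hφ : Measurable fun (y : Fin n → Fin p → ℝ) (a : Fin n) => m + T.mulVec (y a) := by
    have : Continuous fun (y : Fin n → Fin p → ℝ) (a : Fin n) => m + T.mulVec (y a) := by fun_prop
    exact this.measurable
  have hssp : Measurable (sspMatrix : (Fin n → Fin p → ℝ) → Matrix (Fin p) (Fin p) ℝ) :=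
    continuous_sspMatrix.measurable
  have hmap : kotzWishart p n q θ s m S = μ.map fun y => T * sspMatrix y * T.transpose := by
    rw [kotzWishart, hc, Measure.map_map hssp hφ]
    congr 1
    funext y
    exact sspMatrix_add_mulVec hn0.ne' m T y
  have hΦ : Measurable fun y : Fin n → Fin p → ℝ => T * sspMatrix y * T.transpose :=
    ((continuous_const.matrix_mul continuous_sspMatrix).matrix_mul continuous_const).measurable
  have hμprob : IsProbabilityMeasure μ := by
    rw [hmap] at hprob
    exact (Measure.isProbabilityMeasure_map_iff hΦ.aemeasurable).1 hprob
  -- Total mass one fixes `c`, so the explicit constant in `kotzGenerator` is never evaluated; every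
  -- mean is a ratio of two integrals.
  have hmass : c * ∫⁻ y, w y = 1 := by
    have h1 := hμprob.measure_univ
    rwa [hμ, withDensity_apply _ MeasurableSet.univ, Measure.restrict_univ,
      lintegral_const_mul _ hwm] at h1
  have hlint : ∀ (F : (Fin n → Fin p → ℝ) → ℝ≥0∞) (x : ℝ≥0∞), Measurable F →
      ∫⁻ y, F y * w y = x * ∫⁻ y, w y → ∫⁻ y, F y ∂μ = x := by
    intro F x hF hx
    rw [hμ, lintegral_withDensity_eq_lintegral_mul _ (hwm.const_mul c) hF]
    simp only [Pi.mul_apply]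
    calc ∫⁻ y, c * w y * F y = ∫⁻ y, c * (F y * w y) := lintegral_congr fun y => by ring
      _ = x * (c * ∫⁻ y, w y) := by
          rw [lintegral_const_mul (f := fun y => F y * w y) _ (hF.mul hwm), hx]
          ring
      _ = x := by rw [hmass, mul_one]
  have hg : Measurable fun z => c * kotzRadial q θ s z := by fun_prop
  have hd2 : 0 < 2 * s := by positivity
  obtain ⟨hQint, hQ⟩ := integrable_and_integral_eq_of_lintegral_ofReal (μ := μ)
    measurable_sampleNormSq.aestronglyMeasurable (ae_of_all _ sampleNormSq_nonneg)
    (κ := θ ^ (-1 / s) * Real.Gamma ((2 * q + n * p) / (2 * s)) /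
      Real.Gamma ((2 * q + n * p - 2) / (2 * s)))
    (by
      have := Real.Gamma_pos_of_pos (s := (2 * q + n * p - 2) / (2 * s))
        (div_pos (by linarith) hd2)
      have := Real.Gamma_pos_of_pos (s := (2 * q + n * p) / (2 * s)) (div_pos (by linarith) hd2)
      positivity)
    (hlint _ _ (by fun_prop) (lintegral_sampleNormSq_mul_kotzRadial hp hn0 hθ hs (by linarith)))
  refine ⟨T, T', μ, h, hT, hmap, ?_, fun i j => ?_, fun i j => ?_⟩
  · refine (withDensity_absolutelyContinuous _ _).ae_le ?_
    filter_upwards [ae_sampleCol_notMem_otherSpan (p := p) (n := n) (by omega)] with y hy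
    exact posDef_sspMatrix hy
  · have h1 := integral_sspMatrix hg hμ hQint hQ hn0.ne' i j
    refine ⟨h1.1, h1.2.trans ?_⟩
    congr 1
    rw [kotzC1, mul_div_assoc', mul_div_assoc', div_div, mul_comm (n * p : ℝ), mul_assoc ((n : ℝ) - 1)]
  · exact integral_inv_sspMatrix hn0.ne' hg hμ (inv_pos.2 (kotzC0_pos hp hn hθ hs hd)).le
      (fun k => hlint _ _ (measurable_inv_sspMatrix k k).ennreal_ofReal
        (lintegral_inv_sspMatrix_mul_kotzRadial hp hn hθ hs hd k)) i j

/-- Multiples of the identity become multiples of `T * Tᵀ = S` for `A` and of `Tᵀ⁻¹ * T⁻¹ = S⁻¹` for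
its inverse. That the Kotz-Wishart measure has mass one is read off from `hA`. -/
theorem kotzWishart_moments {Ω : Type*} [MeasurableSpace Ω] (P : Measure Ω)
    [IsProbabilityMeasure P] {p n : ℕ} (hp : 0 < p) (hn : p + 2 < n) {q θ s : ℝ} (hθ : 0 < θ)
    (hs : 0 < s) (hq : 2 < 2 * q + p) (m : Fin p → ℝ) {S : Matrix (Fin p) (Fin p) ℝ}
    (hS : S.PosDef) {A : Ω → Matrix (Fin p) (Fin p) ℝ}
    (hA : HasLaw A (kotzWishart p n q θ s m S) P) :
    (∀ᵐ ω ∂P, (A ω).PosDef) ∧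
    (∀ i j, Integrable (fun ω => A ω i j) P ∧ ∫ ω, A ω i j ∂P = kotzC1 p n q θ s * S i j) ∧
    (∀ i j, Integrable (fun ω => (A ω)⁻¹ i j) P ∧
      ∫ ω, (A ω)⁻¹ i j ∂P = (kotzC0 p n q θ s)⁻¹ * S⁻¹ i j) := by
  obtain ⟨T, T', μ, h, hT, hmap, hpos, hW, hWinv⟩ := exists_kotzWishart_eq_map hp hn hθ hs hq m hS
    (hA.isProbabilityMeasure_iff.1 inferInstance)
  have hΦ : Measurable fun y : Fin n → Fin p → ℝ => T * sspMatrix y * T.transpose :=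
    ((continuous_const.matrix_mul continuous_sspMatrix).matrix_mul continuous_const).measurable
  have hTdet : IsUnit T.det := Matrix.isUnit_det_of_right_inverse h
  have htransfer : ∀ (G : Matrix (Fin p) (Fin p) ℝ → ℝ) (x : ℝ), Measurable G →
      (Integrable (fun y => G (T * sspMatrix y * T.transpose)) μ ∧
        ∫ y, G (T * sspMatrix y * T.transpose) ∂μ = x) →
      Integrable (fun ω => G (A ω)) P ∧ ∫ ω, G (A ω) ∂P = x := by
    rintro G x hG ⟨h1, h2⟩
    have hGm : ∀ ν : Measure (Matrix (Fin p) (Fin p) ℝ), AEStronglyMeasurable G ν :=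
      fun ν => hG.aestronglyMeasurable
    have h3 : P.map A = μ.map fun y => T * sspMatrix y * T.transpose := hA.map_eq.trans hmap
    constructor
    · have h4 := (integrable_map_measure (hGm _) hΦ.aemeasurable).2 h1
      rw [← h3] at h4
      exact (integrable_map_measure (hGm _) hA.aemeasurable).1 h4
    · rw [← integral_map hA.aemeasurable (hGm _), h3, integral_map hΦ.aemeasurable (hGm _), h2]
  refine ⟨?_, fun i j => htransfer _ _ (measurable_matrix_apply i j) ?_,
    fun i j => htransfer _ _ (measurable_matrix_inv_apply i j) ?_⟩
  · refine ae_of_ae_map hA.aemeasurable ?_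
    rw [hA.map_eq, hmap, ae_map_iff hΦ.aemeasurable (measurableSet_posDef p)]
    filter_upwards [hpos] with y hy
    have hinj : Function.Injective T.vecMul :=
      Matrix.vecMul_injective_iff_isUnit.2 ((Matrix.isUnit_iff_isUnit_det T).2 hTdet)
    have := hy.mul_mul_conjTranspose_same hinj
    rwa [Matrix.conjTranspose_eq_transpose_of_trivial] at this
  · have := integral_mul_mul_apply hW T T.transpose i j
    rwa [hT] at this
  · have h1 : ∀ y : Fin n → Fin p → ℝ, (T * sspMatrix y * T.transpose)⁻¹ =
        T.transpose⁻¹ * (sspMatrix y)⁻¹ * T⁻¹ := fun y => by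
      rw [Matrix.mul_inv_rev, Matrix.mul_inv_rev, Matrix.mul_assoc]
    have h2 := integral_mul_mul_apply hWinv T.transpose⁻¹ T⁻¹ i j
    rw [← Matrix.mul_inv_rev, hT] at h2
    simp only [h1]
    exact h2

theorem mainTheorem6 {Ω : Type*} [MeasurableSpace Ω] (P : Measure Ω) [IsProbabilityMeasure P]
    (p n : ℕ) (hp : 0 < p) (hn : p + 2 < n)
    (q θ s : ℝ) (hθ : 0 < θ) (hs : 0 < s) (hq : 2 < 2 * q + p)
    (m : Fin p → ℝ) (S : Matrix (Fin p) (Fin p) ℝ) (hS : S.PosDef)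
    (A : Ω → Matrix (Fin p) (Fin p) ℝ) (hA : HasLaw A (kotzWishart p n q θ s m S) P) :
    -- the matrix `A` is almost surely positive definite, hence invertible
    (∀ᵐ ω ∂P, (A ω).PosDef) ∧
    -- `E(A) = c₁ S`
    (∀ i j, Integrable (fun ω => A ω i j) P ∧
      ∫ ω, A ω i j ∂P = kotzC1 p n q θ s * S i j) ∧
    -- `c₀ A⁻¹` is an unbiased estimator of `S⁻¹`
    (∀ i j, Integrable (fun ω => (kotzC0 p n q θ s • (A ω)⁻¹) i j) P ∧
      ∫ ω, (kotzC0 p n q θ s • (A ω)⁻¹) i j ∂P = S⁻¹ i j) ∧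
    -- every estimator `α A⁻¹` has a finite risk
    (∀ α : ℝ,
      Integrable (fun ω => efronMorrisLoss ((n : ℝ) - 1) S (α • (A ω)⁻¹) (A ω)) P) ∧
    -- `c₀ A⁻¹` is the unique one of smallest risk
    (∀ α : ℝ, α ≠ kotzC0 p n q θ s →
      efronMorrisRisk P A ((n : ℝ) - 1) S (fun B => kotzC0 p n q θ s • B⁻¹) <
        efronMorrisRisk P A ((n : ℝ) - 1) S (fun B => α • B⁻¹)) ∧
    -- its risk
    efronMorrisRisk P A ((n : ℝ) - 1) S (fun B => kotzC0 p n q θ s • B⁻¹) =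
      (kotzC1 p n q θ s - kotzC0 p n q θ s) / ((n : ℝ) - 1) := by
  have hpR : (1 : ℝ) ≤ p := by exact_mod_cast hp
  have hnR : (p : ℝ) + 3 ≤ n := by exact_mod_cast hn
  have hc0 : 0 < kotzC0 p n q θ s := kotzC0_pos hp hn hθ hs (by nlinarith)
  have hν : 0 < (n : ℝ) - 1 := by linarith
  obtain ⟨hpos, h1, h0⟩ := kotzWishart_moments P hp hn hθ hs hq m hS hA
  have hrisk := efronMorrisRisk_smul_inv (ν := (n : ℝ) - 1) hp hS hpos h1 h0
  refine ⟨hpos, h1, fun i j => ?_, fun α => (hrisk α).1, fun α hα => ?_, ?_⟩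
  · simp only [Matrix.smul_apply, smul_eq_mul]
    refine ⟨(h0 i j).1.const_mul _, ?_⟩
    rw [integral_const_mul, (h0 i j).2, mul_inv_cancel_left₀ hc0.ne']
  · rw [(hrisk α).2, (hrisk _).2]
    refine div_lt_div_of_pos_right ?_ hν
    -- The two risks differ by exactly `(α - c₀)² / c₀`, divided by `ν`.
    have h2 : 0 < (α - kotzC0 p n q θ s) ^ 2 * (kotzC0 p n q θ s)⁻¹ :=
      mul_pos (sq_pos_of_ne_zero (sub_ne_zero.2 hα)) (inv_pos.2 hc0)
    have h3 : kotzC0 p n q θ s * (kotzC0 p n q θ s)⁻¹ = 1 := mul_inv_cancel₀ hc0.ne'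
    nlinarith
  · rw [(hrisk _).2]
    congr 1
    field_simp
    ring
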